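/- **Conventions.** A *metric structure* for a vocabulary $L$ is a nonempty metric space $(M,d)$ with $d\le 1$, together with uniformly continuous finitary operations $M^n\to M$ and uniformly continuous predicates $M^n\to[0,1]$ interpreting the symbols of $L$; tuples carry the maximum metric, and constants are $0$-ary operations. The metric $d$ is a logical symbol, available in every vocabulary. A predicate is *discrete* in $M$ if it only takes the values $0$ and $1$. A *logic for metric structures* $\mathscr L$ consists of a class $\mathscr C$ of metric structures closed under isomorphisms, reducts, renamings and expansions by constants; a set of $L$-sentences for every vocabulary $L$; and a truth value $\varphi^{M}\in[0,1]$ for every $L$-structure $M\in\mathscr C$ and every $L$-sentence $\varphi$, such that $L$-sentences are $L'$-sentences when $L\subseteq L'$, truth values are invariant under isomorphisms, reducts and renamings, all atomic sentences $d(s,t)$ and $P(t_1,\dots,t_n)$ (with closed terms) are available with their usual values, and the sentences are closed under Łukasiewicz implication $\min\{1-x+y,1\}$, rational constants $r\in[0,1]$, and the quantifiers $\exists x\,\varphi(x)$ (value $\sup_{a\in M}\varphi^{(M,a)}$) and $\forall x\,\varphi(x)$ (value $\inf_{a\in M}\varphi^{(M,a)}$). Here an $L$-formula $\varphi(x)$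 is a sentence of $L$ with an additional constant symbol $x$. $\mathscr L$ is *regular* if for every $L$-sentence $\varphi$ and every binary predicate symbol $R\notin L$ there is an $(L\cup\{R\})$-formula $\psi(y)$ such that the following holds for every $(L\cup\{R\})$-structure $M\in\mathscr C$ in which $R$ is discrete. Suppose that for every $b\in M$ the set $M_b=\{a\in M:R^M(a,b)=1\}$ is nonempty and closed under the operations of $L$, and that the $L$-substructure $M{\restriction}M_b$ belongs to $\mathscr C$. Then $\psi^{(M,b)}=\varphi^{M\restriction M_b}$ for every $b\in M$. We assume throughout that $\mathscr C$ is closed under the following constructions: (i) restriction of $M\in\mathscr C$ to $\{a:P^M(a)=1\}$, for a discrete monadic predicate symbol $P$ of its vocabulary, whenever this set is nonempty and closed under the operations of $M$; (ii) expansion by discrete predicates $Q$ with $Q(\bar x)=Q(\bar y)$ whenever $\max_k d(x_k,y_k)<1$; (iii) disjoint sums of families of structures in $\mathscr C$ in pairwise disjoint vocabularies, with distance $1$ between points of different summands, where each symbol has its original meaning on tuples from its own summand and, on all other tuples, functions take a fixed constant value $o$ and predicates the value $0$. (These conditions hold for the class of all metric structures, of all complete ones, of all discrete ones, and of all $1$-Lipschitz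 ones.) A *theory* $T$ is a set of $L$-sentences; its *models* are the $L$-structures in $\mathscr C$ in which all its sentences have value $1$. $T$ is *uniform* if every function symbol and every predicate symbol of $L$ has a modulus of uniform continuity that is valid in all models of $T$. Let $(\mathbb D,\preceq)$ be a directed set without largest element. A *sampling* $\eta$ of $\mathbb D$ assigns to each $i\in\mathbb D$ a nonempty finite set $\eta_i\subseteq\{j: i\preceq j\}$. Let $t_\bullet=(t_i)_{i\in\mathbb D}$ be a family of closed $L$-terms. It is *Cauchy modulo $T$* if $(t_i^M)_{i\in\mathbb D}$ is a Cauchy net in every model $M$ of $T$. It is *uniformly metastable modulo $T$* if there are nonempty finite sets $E_{\epsilon,\eta}\subseteq\mathbb D$, for $\epsilon>0$ and samplings $\eta$, such that for every model $M$ of $T$, every $\epsilon>0$ and every $\eta$ there is $i\in E_{\epsilon,\eta}$ with $d(t_j^M,t_k^M)\le\epsilon$ for all $j,k\in\eta_i$. The *Uniform Metastability Principle holds in $\mathscr L$ for $\mathbb D$-nets* if, for every vocabulary $L$, every uniform $L$-theory $T$ of $\mathscr L$ and every family $t_\bullet=(t_i)_{i\in\mathbb D}$ of closed $L$-terms, $t_\bullet$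 is Cauchy modulo $T$ if and only if $t_\bullet$ is uniformly metastable modulo $T$. **Theorem.** Let $\mathscr L$ be a regular logic for metric structures and let $\kappa$ be an infinite cardinal less than the first measurable cardinal, i.e. less than every uncountable cardinal $\mu$ that carries a nonprincipal $\mu$-complete ultrafilter (no condition if there is none). If the Uniform Metastability Principle holds in $\mathscr L$ for $\kappa$-sequences (nets indexed by the ordinals below $\kappa$ with their usual order), then it holds in $\mathscr L$ for $\omega$-sequences. -/

import Mathlib

universe u v w

set_option linter.checkUnivs false
noncomputable section

/-! ### Metric structures -/

/-- A metric structure for the vocabulary `L`: a nonempty metric space of diameter at most `1`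
with uniformly continuous operations and uniformly continuous `[0,1]`-valued predicates. The
metric is a logical symbol, present in every vocabulary. Function symbols of arity `0` are
constants. Tuples carry the maximum metric. -/
structure MetricStr (L : FirstOrder.Language.{u, u}) where
  carrier : Type u
  nonempty : Nonempty carrier
  metric : MetricSpace carrier
  dist_le_one : ∀ x y : carrier, dist x y ≤ 1
  fn : ∀ {n : ℕ}, L.Functions n → (Fin n → carrier) → carrier
  pred : ∀ {n : ℕ}, L.Relations n → (Fin n → carrier) → unitInterval
  fn_uc : ∀ {n : ℕ} (f : L.Functions n), UniformContinuous (fn f)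
  pred_uc : ∀ {n : ℕ} (P : L.Relations n), UniformContinuous (pred P)

attribute [instance] MetricStr.nonempty MetricStr.metric

namespace MetricStr

/-- Value of a closed term. -/
def term {L : FirstOrder.Language.{u, u}} (M : MetricStr L) : L.Term Empty → M.carrier
  | .var e => e.elim
  | .func f ts => M.fn f (fun k => M.term (ts k))

/-- Isomorphisms: bijective isometries that respect all symbols. -/
structure Iso {L : FirstOrder.Language.{u, u}} (M N : MetricStr L) where
  toEquiv : M.carrier ≃ N.carrier
  dist_eq : ∀ x y, dist (toEquiv x) (toEquiv y) = dist x y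
  map_fn : ∀ {n : ℕ} (f : L.Functions n) (x : Fin n → M.carrier),
    toEquiv (M.fn f x) = N.fn f (fun k => toEquiv (x k))
  map_pred : ∀ {n : ℕ} (P : L.Relations n) (x : Fin n → M.carrier),
    M.pred P x = N.pred P (fun k => toEquiv (x k))

/-- The reduct of an `L'`-structure along a map of vocabularies `L → L'`. For an injective map,
this is a reduct (to the image) followed by a renaming. -/
abbrev reduct {L L' : FirstOrder.Language.{u, u}} (ρ : L →ᴸ L') (M : MetricStr L') : MetricStr L where
  carrier := M.carrier
  nonempty := M.nonempty
  metric := M.metric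
  dist_le_one := M.dist_le_one
  fn := fun f => M.fn (ρ.onFunction f)
  pred := fun P => M.pred (ρ.onRelation P)
  fn_uc := fun f => M.fn_uc (ρ.onFunction f)
  pred_uc := fun P => M.pred_uc (ρ.onRelation P)

/-- `A` is nonempty and closed under all operations of `M` (constants included). -/
def ClosedSet {L : FirstOrder.Language.{u, u}} (M : MetricStr L) (A : Set M.carrier) : Prop :=
  A.Nonempty ∧ ∀ {n : ℕ} (f : L.Functions n) (x : Fin n → M.carrier),
    (∀ k, x k ∈ A) → M.fn f x ∈ A

/-- The substructure of `M` with universe `A`. -/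
abbrev restrict {L : FirstOrder.Language.{u, u}} (M : MetricStr L) (A : Set M.carrier) (hA : M.ClosedSet A) :
    MetricStr L where
  carrier := A
  nonempty := hA.1.to_subtype
  metric := inferInstance
  dist_le_one := fun x y => M.dist_le_one x y
  fn := fun f x => ⟨M.fn f (fun k => (x k : M.carrier)), hA.2 f _ (fun k => (x k).2)⟩
  pred := fun P x => M.pred P (fun k => (x k : M.carrier))
  fn_uc := fun f => by
    refine UniformContinuous.subtype_mk ?_ _
    refine (M.fn_uc f).comp (uniformContinuous_pi.2 fun k => ?_)
    exact uniformContinuous_subtype_val.comp (Pi.uniformContinuous_proj _ k)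
  pred_uc := fun P => by
    refine (M.pred_uc P).comp (uniformContinuous_pi.2 fun k => ?_)
    exact uniformContinuous_subtype_val.comp (Pi.uniformContinuous_proj _ k)

/-- A predicate is discrete if it only takes the values `0` and `1`. -/
def Discrete {L : FirstOrder.Language.{u, u}} (M : MetricStr L) {n : ℕ} (P : L.Relations n) : Prop :=
  ∀ x, M.pred P x = 0 ∨ M.pred P x = 1

end MetricStr

/-! ### Extending a vocabulary by one fresh symbol -/

/-- A single constant symbol. -/
inductive VarSym : ℕ → Type u
  | c : VarSym 0

/-- A single binary predicate symbol. -/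
inductive BinSym : ℕ → Type u
  | R : BinSym 2

/-- `L` with a fresh constant symbol (a free variable): sentences of `withVar L` are the
`L`-formulas in one variable. -/
abbrev withVar (L : FirstOrder.Language.{u, u}) : FirstOrder.Language.{u, u} :=
  ⟨fun n => L.Functions n ⊕ VarSym.{u} n, L.Relations⟩

/-- `L` with a fresh binary predicate symbol. -/
abbrev withBin (L : FirstOrder.Language.{u, u}) : FirstOrder.Language.{u, u} :=
  ⟨L.Functions, fun n => L.Relations n ⊕ BinSym.{u} n⟩

/-- The fresh binary predicate symbol. -/
abbrev binR (L : FirstOrder.Language.{u, u}) : (withBin L).Relations 2 := Sum.inr BinSym.R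

/-- The inclusion of `L` in `withBin L`. -/
abbrev inclBin (L : FirstOrder.Language.{u, u}) : L →ᴸ withBin L where
  onFunction := fun _ f => f
  onRelation := fun _ P => Sum.inl P

/-- `(M, a)`: the expansion of `M` in which the fresh constant denotes `a`. -/
abbrev MetricStr.addVar {L : FirstOrder.Language.{u, u}} (M : MetricStr L) (a : M.carrier) :
    MetricStr (withVar L) where
  carrier := M.carrier
  nonempty := M.nonempty
  metric := M.metric
  dist_le_one := M.dist_le_one
  fn := fun f x => Sum.elim (fun g => M.fn g x) (fun _ => a) f
  pred := fun P => M.pred (L := L) P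
  fn_uc := fun f => by
    rcases f with g | _
    · exact M.fn_uc g
    · exact uniformContinuous_const
  pred_uc := fun P => M.pred_uc (L := L) P

/-! ### Disjoint sums -/

/-- The disjoint union of a family of vocabularies. -/
abbrev sumLang {I : Type u} (Λ : I → FirstOrder.Language.{u, u}) : FirstOrder.Language.{u, u} :=
  ⟨fun n => Σ i, (Λ i).Functions n, fun n => Σ i, (Λ i).Relations n⟩

namespace DisjSum

variable {I : Type u} {C : I → Type u}

/-- The disjoint union of metric spaces of diameter at most `1`, with distance `1` between points
of different summands. -/
def sumDist [∀ i, MetricSpace (C i)] (p q : Σ i, C i) : ℝ :=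
  open Classical in if h : p.1 = q.1 then dist (h ▸ p.2) q.2 else 1

theorem sumDist_same [∀ i, MetricSpace (C i)] (i : I) (x y : C i) :
    sumDist (⟨i, x⟩ : Σ i, C i) ⟨i, y⟩ = dist x y := by
  simp [sumDist]

theorem sumDist_ne [∀ i, MetricSpace (C i)] {p q : Σ i, C i} (h : p.1 ≠ q.1) :
    sumDist p q = 1 := by
  simp [sumDist, h]

/-- The metric of the disjoint union. -/
abbrev sumMetric [∀ i, MetricSpace (C i)] (h1 : ∀ i, ∀ x y : C i, dist x y ≤ 1) :
    MetricSpace (Σ i, C i) where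
  dist := sumDist
  dist_self := fun ⟨i, x⟩ => by rw [sumDist_same, dist_self]
  dist_comm := fun ⟨i, x⟩ ⟨j, y⟩ => by
    by_cases h : i = j
    · subst h
      rw [sumDist_same, sumDist_same, dist_comm]
    · rw [sumDist_ne h, sumDist_ne (Ne.symm h)]
  dist_triangle := fun ⟨i, x⟩ ⟨j, y⟩ ⟨k, z⟩ => by
    have pos : ∀ p q : Σ i, C i, 0 ≤ sumDist p q := by
      rintro ⟨i, x⟩ ⟨j, y⟩
      by_cases h : i = j
      · subst h
        rw [sumDist_same]
        exact dist_nonneg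
      · rw [sumDist_ne h]
        exact zero_le_one
    by_cases hij : i = j
    · subst hij
      by_cases hjk : i = k
      · subst hjk
        rw [sumDist_same, sumDist_same, sumDist_same]
        exact dist_triangle x y z
      · rw [sumDist_ne hjk, sumDist_ne (p := ⟨i, y⟩) hjk]
        linarith [pos ⟨i, x⟩ ⟨i, y⟩]
    · rw [sumDist_ne (p := ⟨i, x⟩) (q := ⟨j, y⟩) hij]
      have : sumDist (⟨i, x⟩ : Σ i, C i) ⟨k, z⟩ ≤ 1 := by
        by_cases hik : i = k
        · subst hik
          rw [sumDist_same]
          exact h1 i x z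
        · rw [sumDist_ne hik]
      linarith [pos ⟨j, y⟩ ⟨k, z⟩]
  eq_of_dist_eq_zero := by
    rintro ⟨i, x⟩ ⟨j, y⟩ h
    by_cases hij : i = j
    · subst hij
      have h' : sumDist (⟨i, x⟩ : Σ i, C i) ⟨i, y⟩ = 0 := h
      rw [sumDist_same] at h'
      rw [eq_of_dist_eq_zero h']
    · have h' : sumDist (⟨i, x⟩ : Σ i, C i) ⟨j, y⟩ = 0 := h
      rw [sumDist_ne hij] at h'
      exact absurd h' one_ne_zero

/-- Extend a map defined on the tuples of the `i`-th summand to all tuples of the union, with the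
constant value `o` elsewhere. -/
def extend {n : ℕ} {Z : Type w} (i : I) (F : (Fin n → C i) → Z) (o : Z)
    (x : Fin n → Σ i, C i) : Z :=
  open Classical in if h : ∀ k, (x k).1 = i then F (fun k => h k ▸ (x k).2) else o

theorem extend_mk {n : ℕ} {Z : Type w} (i : I) (F : (Fin n → C i) → Z) (o : Z)
    (x : Fin n → C i) : extend i F o (fun k => (⟨i, x k⟩ : Σ i, C i)) = F x := by
  simp [extend]

theorem extend_of_not {n : ℕ} {Z : Type w} (i : I) (F : (Fin n → C i) → Z) (o : Z)
    (x : Fin n → Σ i, C i) (h : ¬ ∀ k, (x k).1 = i) : extend i F o x = o := by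
  simp only [extend, dif_neg h]

theorem exists_mk {n : ℕ} (i : I) (x : Fin n → Σ i, C i) (h : ∀ k, (x k).1 = i) :
    ∃ x' : Fin n → C i, x = fun k => ⟨i, x' k⟩ := by
  have H : ∀ k, ∃ z : C i, x k = ⟨i, z⟩ := by
    intro k
    have hk := h k
    generalize x k = p at hk
    obtain ⟨j, z⟩ := p
    obtain rfl : j = i := hk
    exact ⟨z, rfl⟩
  choose x' hx' using H
  exact ⟨x', funext hx'⟩

theorem fst_eq_of_dist_lt [∀ i, MetricSpace (C i)] {p q : Σ i, C i} (h : sumDist p q < 1) :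
    p.1 = q.1 := by
  by_contra hne
  rw [sumDist_ne hne] at h
  exact lt_irrefl _ h

theorem extend_uc [∀ i, MetricSpace (C i)] (h1 : ∀ i, ∀ x y : C i, dist x y ≤ 1)
    {n : ℕ} {Z : Type w} [PseudoMetricSpace Z] (i : I) (F : (Fin n → C i) → Z) (o : Z)
    (hF : UniformContinuous F) :
    let := sumMetric h1
    UniformContinuous (extend i F o) := by
  let := sumMetric h1
  rw [Metric.uniformContinuous_iff] at hF ⊢
  intro ε hε
  obtain ⟨δ, hδ, H⟩ := hF ε hε
  refine ⟨min δ 1, lt_min hδ one_pos, fun {x y} hxy => ?_⟩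
  have hk := (dist_pi_lt_iff (lt_min hδ one_pos)).1 hxy
  have hfst : ∀ k, (x k).1 = (y k).1 := fun k =>
    fst_eq_of_dist_lt (lt_of_lt_of_le (hk k) (min_le_right _ _))
  by_cases hx : ∀ k, (x k).1 = i
  · have hy : ∀ k, (y k).1 = i := fun k => (hfst k).symm.trans (hx k)
    have ex := exists_mk i x hx
    have ey := exists_mk i y hy
    obtain ⟨x', rfl⟩ := ex
    obtain ⟨y', rfl⟩ := ey
    rw [extend_mk, extend_mk]
    refine H ((dist_pi_lt_iff hδ).2 fun k => ?_)
    have h2 : sumDist (⟨i, x' k⟩ : Σ i, C i) ⟨i, y' k⟩ < min δ 1 := hk k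
    rw [sumDist_same] at h2
    exact lt_of_lt_of_le h2 (min_le_left _ _)
  · have hy : ¬ ∀ k, (y k).1 = i := fun h => hx fun k => (hfst k).trans (h k)
    rw [extend_of_not i F o x hx, extend_of_not i F o y hy, dist_self]
    exact hε

end DisjSum

/-- The disjoint sum of a family of metric structures for pairwise disjoint vocabularies. Points
of different summands are at distance `1`. A symbol of the `i`-th vocabulary has its original
meaning on tuples of the `i`-th summand; elsewhere, functions take the constant value `o`
and predicates the value `0`. -/
abbrev MetricStr.sum {I : Type u} {Λ : I → FirstOrder.Language.{u, u}} (M : ∀ i, MetricStr (Λ i))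
    (o : Σ i, (M i).carrier) : MetricStr (sumLang Λ) where
  carrier := Σ i, (M i).carrier
  nonempty := ⟨o⟩
  metric := DisjSum.sumMetric fun i => (M i).dist_le_one
  dist_le_one := by
    rintro ⟨i, x⟩ ⟨j, y⟩
    by_cases h : i = j
    · subst h
      have h' := (M i).dist_le_one x y
      rw [← DisjSum.sumDist_same (C := fun i => (M i).carrier) i x y] at h'
      exact h'
    · exact (DisjSum.sumDist_ne h).le
  fn := fun f => DisjSum.extend f.1 (fun x => (⟨f.1, (M f.1).fn f.2 x⟩ : Σ i, (M i).carrier)) o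
  pred := fun P => DisjSum.extend P.1 ((M P.1).pred P.2) 0
  fn_uc := fun {n} f => by
    let := DisjSum.sumMetric (C := fun i => (M i).carrier) fun i => (M i).dist_le_one
    refine DisjSum.extend_uc (C := fun i => (M i).carrier) (fun i => (M i).dist_le_one) f.1 _ o ?_
    have h := (M f.1).fn_uc f.2
    rw [Metric.uniformContinuous_iff] at h ⊢
    intro ε hε
    obtain ⟨δ, hδ, H⟩ := h ε hε
    refine ⟨δ, hδ, fun {x y} hxy => ?_⟩
    have h2 := H hxy
    exact (DisjSum.sumDist_same (C := fun i => (M i).carrier) f.1 _ _).trans_lt h2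
  pred_uc := fun P =>
    DisjSum.extend_uc (C := fun i => (M i).carrier) (fun i => (M i).dist_le_one) P.1 _ 0
      ((M P.1).pred_uc P.2)

/-! ### Logics -/

/-- A `[0,1]`-valued logic all of whose structures are metric structures. `Mem` is the class of
structures of the logic, and `val` is the truth value; it is only meaningful on structures in
the class. An injective map of vocabularies is a renaming followed by an inclusion, so
`reduct_mem` says that the class is closed under reducts and renamings, and `translate` combines
the monotonicity of `Sent`, the reduct property and the renaming property. -/
structure MetricValuedLogic where
  Sent : FirstOrder.Language.{u, u} → Type v
  Mem : ∀ {L : FirstOrder.Language.{u, u}}, MetricStr L → Prop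
  val : ∀ {L : FirstOrder.Language.{u, u}}, MetricStr L → Sent L → unitInterval
  iso_mem : ∀ {L : FirstOrder.Language.{u, u}} {M N : MetricStr L}, M.Iso N → Mem M → Mem N
  reduct_mem : ∀ {L L' : FirstOrder.Language.{u, u}} (ρ : L →ᴸ L') (M : MetricStr L'),
    ρ.Injective → Mem M → Mem (M.reduct ρ)
  iso_val : ∀ {L : FirstOrder.Language.{u, u}} {M N : MetricStr L} (φ : Sent L),
    M.Iso N → Mem M → val M φ = val N φ
  translate : ∀ {L L' : FirstOrder.Language.{u, u}} (ρ : L →ᴸ L'), ρ.Injective → ∀ φ : Sent L,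
    ∃ φ' : Sent L', ∀ M : MetricStr L', Mem M → val M φ' = val (M.reduct ρ) φ

namespace MetricValuedLogic

variable (ℒ : MetricValuedLogic.{u, v})

/-- A logic for metric structures: it contains the atomic sentences and is closed under
Łukasiewicz implication, rational constants, and the quantifiers `sup` and `inf`. Expansions
of structures of the logic by constants belong to the logic, so that formulas can be evaluated at
parameters. -/
structure IsLogicForMetricStructures : Prop where
  constants_mem : ∀ {L L' : FirstOrder.Language.{u, u}} (ρ : L →ᴸ L') (M : MetricStr L'), ρ.Injective →
    (∀ (n : ℕ) (f : L'.Functions (n + 1)), ∃ g, ρ.onFunction g = f) →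
    (∀ (n : ℕ) (P : L'.Relations n), ∃ Q, ρ.onRelation Q = P) →
    ℒ.Mem (M.reduct ρ) → ℒ.Mem M
  atomic_dist : ∀ {L : FirstOrder.Language.{u, u}} (s t : L.Term Empty),
    ∃ χ : ℒ.Sent L, ∀ M : MetricStr L, ℒ.Mem M →
      (ℒ.val M χ : ℝ) = dist (M.term s) (M.term t)
  atomic_pred : ∀ {L : FirstOrder.Language.{u, u}} {n : ℕ} (P : L.Relations n) (t : Fin n → L.Term Empty),
    ∃ χ : ℒ.Sent L, ∀ M : MetricStr L, ℒ.Mem M →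
      ℒ.val M χ = M.pred P (fun k => M.term (t k))
  imp : ∀ {L : FirstOrder.Language.{u, u}} (φ ψ : ℒ.Sent L),
    ∃ χ : ℒ.Sent L, ∀ M : MetricStr L, ℒ.Mem M →
      (ℒ.val M χ : ℝ) = min (1 - (ℒ.val M φ : ℝ) + (ℒ.val M ψ : ℝ)) 1
  const : ∀ (L : FirstOrder.Language.{u, u}) (r : ℚ), 0 ≤ r → r ≤ 1 →
    ∃ χ : ℒ.Sent L, ∀ M : MetricStr L, ℒ.Mem M → (ℒ.val M χ : ℝ) = r
  ex : ∀ {L : FirstOrder.Language.{u, u}} (φ : ℒ.Sent (withVar L)),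
    ∃ χ : ℒ.Sent L, ∀ M : MetricStr L, ℒ.Mem M →
      IsLUB (Set.range fun a : M.carrier => ℒ.val (M.addVar a) φ) (ℒ.val M χ)
  all : ∀ {L : FirstOrder.Language.{u, u}} (φ : ℒ.Sent (withVar L)),
    ∃ χ : ℒ.Sent L, ∀ M : MetricStr L, ℒ.Mem M →
      IsGLB (Set.range fun a : M.carrier => ℒ.val (M.addVar a) φ) (ℒ.val M χ)

/-- The truth set of `R(·, b)`, for the fresh binary predicate symbol `R`. -/
def fiber {L : FirstOrder.Language.{u, u}} (M : MetricStr (withBin L)) (b : M.carrier) : Set M.carrier :=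
  {a | M.pred (binR L) ![a, b] = 1}

/-- Regularity: the logic permits relativization to definable families of predicates. For every
sentence `φ` there is a formula `ψ(y)`, the relativization of `φ` to `R(·, y)`, with the following
property. If `R` is discrete in `M` and, for all `b`, restricting the universe of `M` to the truth
set of `R(·, b)` yields a structure of the logic for the vocabulary of `φ`, then the value of `ψ`
at `b` is the value of `φ` in that structure, for all `b`. -/
def IsRegular : Prop :=
  ∀ {L : FirstOrder.Language.{u, u}} (φ : ℒ.Sent L), ∃ ψ : ℒ.Sent (withVar (withBin L)),
    ∀ M : MetricStr (withBin L), ℒ.Mem M → M.Discrete (binR L) →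
      ∀ hcl : ∀ b, (M.reduct (inclBin L)).ClosedSet (fiber M b),
        (∀ b, ℒ.Mem ((M.reduct (inclBin L)).restrict (fiber M b) (hcl b))) →
        ∀ b, ℒ.val (M.addVar b) ψ =
          ℒ.val ((M.reduct (inclBin L)).restrict (fiber M b) (hcl b)) φ

/-- Standing closure conditions on the class of structures of the logic: it is closed under
restriction to discrete monadic predicates, under expansion by discrete predicates
that do not change along distances `< 1`, and under disjoint sums. They hold for the class of all
metric structures, of all complete ones, of all discrete ones, and of all `1`-Lipschitz ones. -/
structure HasStandardConstructions : Prop where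
  restrict_mem : ∀ {L : FirstOrder.Language.{u, u}} (M : MetricStr L) (P : L.Relations 1)
    (h : M.ClosedSet {a | M.pred P ![a] = 1}), ℒ.Mem M → M.Discrete P →
    ℒ.Mem (M.restrict {a | M.pred P ![a] = 1} h)
  discrete_mem : ∀ {L L' : FirstOrder.Language.{u, u}} (ρ : L →ᴸ L') (M : MetricStr L'), ρ.Injective →
    (∀ (n : ℕ) (f : L'.Functions n), ∃ g, ρ.onFunction g = f) →
    (∀ (n : ℕ) (P : L'.Relations n), (∃ Q, ρ.onRelation Q = P) ∨
      (M.Discrete P ∧ ∀ x y : Fin n → M.carrier, dist x y < 1 → M.pred P x = M.pred P y)) →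
    ℒ.Mem (M.reduct ρ) → ℒ.Mem M
  sum_mem : ∀ {I : Type u} {Λ : I → FirstOrder.Language.{u, u}} (M : ∀ i, MetricStr (Λ i))
    (o : Σ i, (M i).carrier), (∀ i, ℒ.Mem (M i)) → ℒ.Mem (MetricStr.sum M o)

/-- `M` is a model, in the logic, of the theory `T`. -/
def Models {L : FirstOrder.Language.{u, u}} (T : Set (ℒ.Sent L)) (M : MetricStr L) : Prop :=
  ℒ.Mem M ∧ ∀ φ ∈ T, ℒ.val M φ = 1

/-- The theory `T` is uniform: each function symbol and each predicate symbol has a modulus of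
uniform continuity valid in all models of `T`. -/
def Uniform {L : FirstOrder.Language.{u, u}} (T : Set (ℒ.Sent L)) : Prop :=
  (∀ (n : ℕ) (f : L.Functions n), ∃ Δ : ℝ → ℝ, (∀ ε > 0, 0 < Δ ε) ∧
    ∀ M : MetricStr L, ℒ.Models T M → ∀ ε > 0, ∀ x y : Fin n → M.carrier,
      dist x y < Δ ε → dist (M.fn f x) (M.fn f y) ≤ ε) ∧
  (∀ (n : ℕ) (P : L.Relations n), ∃ Δ : ℝ → ℝ, (∀ ε > 0, 0 < Δ ε) ∧
    ∀ M : MetricStr L, ℒ.Models T M → ∀ ε > 0, ∀ x y : Fin n → M.carrier,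
      dist x y < Δ ε → dist (M.pred P x) (M.pred P y) ≤ ε)

end MetricValuedLogic

/-! ### Metastability -/

/-- A sampling of a partially ordered set. -/
structure Sampling (D : Type w) [PartialOrder D] where
  set : D → Finset D
  nonempty : ∀ i, (set i).Nonempty
  le_of_mem : ∀ i, ∀ j ∈ set i, i ≤ j

namespace MetricValuedLogic

variable (ℒ : MetricValuedLogic.{u, v}) {D : Type w} [PartialOrder D]

/-- The family `t` of closed terms is Cauchy modulo `T`. -/
def CauchyModulo {L : FirstOrder.Language.{u, u}} (T : Set (ℒ.Sent L)) (t : D → L.Term Empty) : Prop :=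
  ∀ M : MetricStr L, ℒ.Models T M →
    ∀ ε > 0, ∃ i : D, ∀ j k : D, i ≤ j → i ≤ k → dist (M.term (t j)) (M.term (t k)) ≤ ε

/-- The family `t` of closed terms is uniformly metastable modulo `T`: some rate of metastability
`E` applies to the values of `t` in all models of `T`. -/
def UniformlyMetastableModulo {L : FirstOrder.Language.{u, u}} (T : Set (ℒ.Sent L)) (t : D → L.Term Empty) :
    Prop :=
  ∃ E : ℝ → Sampling D → Finset D, (∀ ε > 0, ∀ η, (E ε η).Nonempty) ∧
    ∀ M : MetricStr L, ℒ.Models T M → ∀ ε > 0, ∀ η : Sampling D,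
      ∃ i ∈ E ε η, ∀ j ∈ η.set i, ∀ k ∈ η.set i, dist (M.term (t j)) (M.term (t k)) ≤ ε

/-- The Uniform Metastability Principle for `D`-nets. -/
def UMP (D : Type w) [PartialOrder D] : Prop :=
  ∀ {L : FirstOrder.Language.{u, u}} (T : Set (ℒ.Sent L)) (t : D → L.Term Empty), ℒ.Uniform T →
    (ℒ.CauchyModulo T t ↔ ℒ.UniformlyMetastableModulo T t)

end MetricValuedLogic

/-- Measurable cardinals: uncountable cardinals `μ` that carry a nonprincipal `μ`-complete
ultrafilter. -/
def IsMeasurableCardinal (μ : Cardinal.{u}) : Prop :=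
  Cardinal.aleph0 < μ ∧ ∃ U : Ultrafilter μ.ord.ToType,
    (∀ a, {a} ∉ U) ∧ CardinalInterFilter (U : Filter μ.ord.ToType) μ

end

/-! Suppose `t` is Cauchy modulo `T` but not uniformly metastable. For some `ε` and `η` there are
models `A n` of `T` in which `t` oscillates by more than `ε` on `η.set i` for every `i ≤ n`. No
model of `T` oscillates by a fixed positive amount on every `η.set i`. So sentences `φ i` saying
"`t` oscillates on `η.set i`" give a countable failure of compactness over `T`.

Let `D` be the set of ordinals below `κ`. For `γ : D`, `sumStr A γ` is the disjoint sum of the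
structures `A (f γ)` over all `f : D → ℕ`, with propositions telling which subsets of `D` contain
`γ`, and with a `D`-sequence of constants that is injective up to `γ` and stationary from there. A
model `M` of the common theory of these sums determines an ultrafilter `U` on `D`. By regularity, in
the manner of Łoś, the `f`-part of `M` is a model of `T`, and it satisfies `φ i` whenever `{γ | i ≤
f γ} ∈ U` (`val_part_eq_one`). As no model of `T` satisfies all `φ i`, every `f` is bounded modulo
`U`, so `U` is countably complete (`countableInter_subsetUltrafilter`). Below the first measurable
cardinal this makes `U` principal (`Ultrafilter.exists_singleton_mem_of_no_measurable`), and the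
sequence is stationary in `M` from the generator of `U` on.

Hence the sequence is Cauchy modulo a uniform theory. It is not uniformly metastable, because `γ`
can be taken above any finite set (`not_uniformlyMetastableModulo_seqTerm`). This contradicts the
principle for `κ`. -/

noncomputable section

/-! ### Conditions expressible by sentences. -/

/-- Constant symbols indexed by `C`. -/
inductive ConstSym (C : Type u) : ℕ → Type u
  | c : C → ConstSym C 0

/-- `L` with fresh constant symbols indexed by `C`. -/
abbrev withConsts (L : FirstOrder.Language.{u, u}) (C : Type u) : FirstOrder.Language.{u, u} :=
  ⟨fun n => L.Functions n ⊕ ConstSym C n, L.Relations⟩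

/-- The expansion of `M` by constants. -/
abbrev MetricStr.addConsts {L : FirstOrder.Language.{u, u}} {C : Type u} (M : MetricStr L)
    (x : C → M.carrier) : MetricStr (withConsts L C) where
  carrier := M.carrier
  nonempty := M.nonempty
  metric := M.metric
  dist_le_one := M.dist_le_one
  fn := fun f y => Sum.elim (fun g => M.fn g y) (fun c => match c with | .c i => x i) f
  pred := fun P => M.pred (L := L) P
  fn_uc := fun f => by
    rcases f with g | ⟨⟨i⟩⟩
    · exact M.fn_uc g
    · exact uniformContinuous_const
  pred_uc := fun P => M.pred_uc (L := L) P

/-- The closed term consisting of a fresh constant. -/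
def constTerm (L : FirstOrder.Language.{u, u}) {C : Type u} (c : C) :
    (withConsts L C).Term Empty :=
  .func (Sum.inr (.c c)) Fin.elim0

namespace MetricValuedLogic

variable {ℒ : MetricValuedLogic.{u, v}} {L L' : FirstOrder.Language.{u, u}}

theorem mem_addVar (hℒ : ℒ.IsLogicForMetricStructures) {M : MetricStr L} (hM : ℒ.Mem M)
    (a : M.carrier) : ℒ.Mem (M.addVar a) := by
  let ρ : L →ᴸ withVar L := ⟨fun _ f => Sum.inl f, fun _ P => P⟩
  refine hℒ.constants_mem ρ (M.addVar a) ⟨?_, ?_⟩ ?_ ?_ hM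
  · exact fun {n} => Sum.inl_injective
  · exact fun {n} => Function.injective_id
  · rintro n (f | f)
    · exact ⟨f, rfl⟩
    · exact nomatch f
  · exact fun n P => ⟨P, rfl⟩

variable (ℒ) in
/-- `F` is the truth value of some sentence. -/
def Definable (F : MetricStr L → ℝ) : Prop :=
  ∃ χ : ℒ.Sent L, ∀ M, ℒ.Mem M → (ℒ.val M χ : ℝ) = F M

variable (ℒ) in
/-- Among the structures with property `K`, those with property `Q` are the models of some
sentence. -/
def Expressible (K Q : MetricStr L → Prop) : Prop :=
  ∃ χ : ℒ.Sent L, ∀ M, ℒ.Mem M → K M → (ℒ.val M χ = 1 ↔ Q M)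

theorem val_eq_one_iff {M : MetricStr L} {χ : ℒ.Sent L} :
    ℒ.val M χ = 1 ↔ (ℒ.val M χ : ℝ) = 1 := by
  rw [← Set.Icc.coe_one, Subtype.coe_inj]

theorem Expressible.congr {K Q Q' : MetricStr L → Prop} (h : ℒ.Expressible K Q)
    (hQ : ∀ M, ℒ.Mem M → K M → (Q M ↔ Q' M)) : ℒ.Expressible K Q' := by
  obtain ⟨χ, hχ⟩ := h
  exact ⟨χ, fun M hM hk => (hχ M hM hk).trans (hQ M hM hk)⟩

theorem Definable.add_const (hℒ : ℒ.IsLogicForMetricStructures) {F : MetricStr L → ℝ}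
    (hF : ℒ.Definable F) {r : ℚ} (h0 : 0 ≤ r) (h1 : r ≤ 1) :
    ℒ.Definable fun M => min (F M + r) 1 := by
  obtain ⟨φ, hφ⟩ := hF
  -- Implication from `1 - r` adds `1 - (1 - r) = r`.
  obtain ⟨ρ, hρ⟩ := hℒ.const L (1 - r) (by linarith) (by linarith)
  obtain ⟨χ, hχ⟩ := hℒ.imp ρ φ
  refine ⟨χ, fun M hM => ?_⟩
  rw [hχ M hM, hρ M hM, hφ M hM]
  push_cast
  congr 1
  ring

/-- Łukasiewicz implication has value `1` exactly when the premise is at most the conclusion. Only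
closed conditions arise this way, so implications are later written as disjunctions of closed
conditions. -/
theorem Definable.le (hℒ : ℒ.IsLogicForMetricStructures) {F G : MetricStr L → ℝ}
    (hF : ℒ.Definable F) (hG : ℒ.Definable G) (K : MetricStr L → Prop) :
    ℒ.Expressible K fun M => F M ≤ G M := by
  obtain ⟨φ, hφ⟩ := hF
  obtain ⟨ψ, hψ⟩ := hG
  obtain ⟨χ, hχ⟩ := hℒ.imp φ ψ
  refine ⟨χ, fun M hM _ => ?_⟩
  rw [val_eq_one_iff, hχ M hM, hφ M hM, hψ M hM, min_eq_right_iff]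
  constructor <;> intro h <;> linarith

/-- The formula `(φ → ψ) → ψ` has value `max φ ψ`. -/
theorem Expressible.or (hℒ : ℒ.IsLogicForMetricStructures) {K Q Q' : MetricStr L → Prop}
    (hQ : ℒ.Expressible K Q) (hQ' : ℒ.Expressible K Q') :
    ℒ.Expressible K fun M => Q M ∨ Q' M := by
  obtain ⟨φ, hφ⟩ := hQ
  obtain ⟨ψ, hψ⟩ := hQ'
  obtain ⟨χ', hχ'⟩ := hℒ.imp φ ψ
  obtain ⟨χ, hχ⟩ := hℒ.imp χ' ψ
  refine ⟨χ, fun M hM hk => ?_⟩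
  change _ ↔ Q M ∨ Q' M
  rw [← hφ M hM hk, ← hψ M hM hk, val_eq_one_iff, val_eq_one_iff, val_eq_one_iff, hχ M hM,
    hχ' M hM]
  have h1 := (ℒ.val M φ).2.2
  have h2 := (ℒ.val M ψ).2.2
  generalize (ℒ.val M φ : ℝ) = a at *
  generalize (ℒ.val M ψ : ℝ) = b at *
  rcases le_total a b with h | h
  · have e : min (1 - a + b) 1 = 1 := min_eq_right (by linarith)
    rw [e, min_eq_left (by linarith)]
    constructor
    · intro h'; right; linarith
    · rintro (h' | h') <;> linarith
  · have e : min (1 - a + b) 1 = 1 - a + b := min_eq_left (by linarith)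
    rw [e, min_eq_left (by linarith)]
    constructor
    · intro h'; left; linarith
    · rintro (h' | h') <;> linarith

theorem expressible_false (hℒ : ℒ.IsLogicForMetricStructures) (K : MetricStr L → Prop) :
    ℒ.Expressible K fun _ => False := by
  obtain ⟨χ, hχ⟩ := hℒ.const L 0 le_rfl zero_le_one
  refine ⟨χ, fun M hM _ => ?_⟩
  rw [val_eq_one_iff, hχ M hM]
  simp

theorem Expressible.exists_mem (hℒ : ℒ.IsLogicForMetricStructures) {ι : Type w}
    {K : MetricStr L → Prop} {Q : ι → MetricStr L → Prop} (h : ∀ i, ℒ.Expressible K (Q i))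
    (s : Finset ι) : ℒ.Expressible K fun M => ∃ i ∈ s, Q i M := by
  classical
  induction s using Finset.induction_on with
  | empty => exact (expressible_false hℒ K).congr fun M _ _ => by simp
  | insert a s _ ih => exact ((h a).or hℒ ih).congr fun M _ _ => by simp

theorem Expressible.reduct {K Q : MetricStr L → Prop} (h : ℒ.Expressible K Q) (ρ : L →ᴸ L')
    (hρ : ρ.Injective) : ℒ.Expressible (fun M => K (M.reduct ρ)) fun M => Q (M.reduct ρ) := by
  obtain ⟨φ, hφ⟩ := h
  obtain ⟨χ, hχ⟩ := ℒ.translate ρ hρ φ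
  refine ⟨χ, fun M hM hk => ?_⟩
  rw [hχ M hM]
  exact hφ _ (ℒ.reduct_mem ρ M hρ hM) hk

/-- An infimum in `[0,1]` equals `1` iff all values do. A supremum may equal `1` without being
attained, so existential statements need constants as witnesses. -/
theorem Expressible.forall_var (hℒ : ℒ.IsLogicForMetricStructures)
    {K : MetricStr L → Prop} {K' Q : MetricStr (withVar L) → Prop} (h : ℒ.Expressible K' Q)
    (hK : ∀ M, K M → ∀ a, K' (M.addVar a)) :
    ℒ.Expressible K fun M => ∀ a, Q (M.addVar a) := by
  obtain ⟨φ, hφ⟩ := h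
  obtain ⟨χ, hχ⟩ := hℒ.all φ
  refine ⟨χ, fun M hM hk => ?_⟩
  have hglb := hχ M hM
  have key : ℒ.val M χ = 1 ↔ ∀ a, ℒ.val (M.addVar a) φ = 1 := by
    constructor
    · intro h1 a
      exact le_antisymm unitInterval.le_one' (h1 ▸ hglb.1 ⟨a, rfl⟩)
    · intro h1
      refine le_antisymm unitInterval.le_one' (hglb.2 ?_)
      rintro _ ⟨a, rfl⟩
      exact (h1 a).ge
  rw [key]
  exact forall_congr' fun a => hφ _ (mem_addVar hℒ hM a) (hK M hk a)

/-- Induction with `L` varying: the constant `0` becomes the variable of `withVar L`, and the other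
constants shift down by one. -/
theorem Expressible.forall_fin (hℒ : ℒ.IsLogicForMetricStructures) {n : ℕ}
    {Q : MetricStr (withConsts L (ULift.{u} (Fin n))) → Prop}
    (h : ℒ.Expressible (fun _ => True) Q) :
    ℒ.Expressible (fun _ => True) fun M => ∀ x : Fin n → M.carrier,
      Q (M.addConsts fun k => x k.down) := by
  induction n generalizing L with
  | zero =>
    let ρ : withConsts L (ULift.{u} (Fin 0)) →ᴸ L :=
      ⟨fun n f => Sum.elim id (fun c => match c with | .c i => i.down.elim0) f, fun _ P => P⟩
    have hρ : ρ.Injective := by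
      refine ⟨fun {n} => ?_, fun {n} => Function.injective_id⟩
      rintro (f | ⟨⟨⟨i⟩⟩⟩) (g | ⟨⟨⟨j⟩⟩⟩) hfg
      · exact congrArg Sum.inl hfg
      · exact j.elim0
      · exact i.elim0
      · exact i.elim0
    refine (h.reduct ρ hρ).congr fun M hM _ => ?_
    have key : ∀ x : Fin 0 → M.carrier, M.addConsts (fun k : ULift.{u} (Fin 0) => x k.down) =
        M.reduct ρ := by
      intro x
      unfold MetricStr.addConsts MetricStr.reduct
      congr 1
      funext n f
      rcases f with f | ⟨⟨⟨i⟩⟩⟩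
      · rfl
      · exact i.elim0
    constructor
    · intro hQ x
      rw [key x]
      exact hQ
    · intro hQ
      rw [← key Fin.elim0]
      exact hQ _
  | succ n ih =>
    let ρ : withConsts L (ULift.{u} (Fin (n + 1))) →ᴸ withConsts (withVar L) (ULift.{u} (Fin n)) :=
      ⟨fun m f => Sum.elim (fun g => Sum.inl (Sum.inl g)) (fun c => match c with
        | .c i => Fin.cases (Sum.inl (Sum.inr .c)) (fun j => Sum.inr (.c ⟨j⟩)) i.down) f,
        fun _ P => P⟩
    have hρ : ρ.Injective := by
      refine ⟨fun {n} => ?_, fun {n} => Function.injective_id⟩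
      rintro (f | ⟨⟨⟨i⟩⟩⟩) (g | ⟨⟨⟨j⟩⟩⟩) hfg
      · exact congrArg Sum.inl (Sum.inl_injective (Sum.inl_injective hfg))
      · revert hfg
        refine Fin.cases ?_ (fun j => ?_) j <;> intro hfg <;> cases hfg
      · revert hfg
        refine Fin.cases ?_ (fun i => ?_) i <;> intro hfg <;> cases hfg
      · revert hfg
        refine Fin.cases ?_ (fun i => ?_) i <;> refine Fin.cases ?_ (fun j => ?_) j <;>
          intro hfg
        · rfl
        · cases hfg
        · cases hfg
        · have h1 := Sum.inr_injective hfg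
          injection h1 with h2
          injection h2 with h3
          obtain rfl : i = j := h3
          rfl
    refine ((ih (h.reduct ρ hρ)).forall_var (K := fun _ => True) hℒ
      (fun _ _ _ => True.intro)).congr fun M hM _ => ?_
    have key : ∀ (a : M.carrier) (x : Fin n → M.carrier),
        ((M.addVar a).addConsts (fun k : ULift.{u} (Fin n) => x k.down)).reduct ρ =
        M.addConsts (fun k : ULift.{u} (Fin (n + 1)) => Fin.cons (α := fun _ => M.carrier) a x k.down) := by
      intro a x
      unfold MetricStr.addConsts MetricStr.reduct MetricStr.addVar
      congr 1
      funext m f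
      rcases f with f | ⟨⟨⟨i⟩⟩⟩
      · rfl
      · refine Fin.cases ?_ (fun j => ?_) i
        · rfl
        · rfl
    constructor
    · intro hQ x
      have := hQ (x 0) (fun k => x k.succ)
      have hx : x = Fin.cons (α := fun _ => M.carrier) (x 0) (fun k => x k.succ) :=
        (Fin.cons_self_tail x).symm
      rw [hx]
      exact key (x 0) (fun k => x k.succ) ▸ this
    · intro hQ a x
      rw [key]
      exact hQ _

end MetricValuedLogic

/-! ### Countably complete ultrafilters below the measurable cardinals. -/

/-- A countably complete ultrafilter on a set smaller than every measurable cardinal is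
principal. -/
theorem Ultrafilter.exists_singleton_mem_of_no_measurable {D : Type u} (U : Ultrafilter D)
    [CountableInterFilter (U : Filter D)]
    (hmeas : ∀ μ : Cardinal.{u}, IsMeasurableCardinal μ → Cardinal.mk D < μ) :
    ∃ a, {a} ∈ U := by
  classical
  by_contra! hsing
  -- The cardinals at which completeness of `U` fails; the least one will be shown to be measurable.
  let S : Set Cardinal.{u} := {c | ∃ F : c.ord.ToType → Set D, (∀ i, F i ∉ U) ∧ (⋃ i, F i) ∈ U}
  have hfam : ∀ (ι : Type u) (F : ι → Set D), (∀ i, F i ∉ U) → (⋃ i, F i) ∈ U →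
      Cardinal.mk ι ∈ S := by
    intro ι F hF hU
    obtain ⟨e⟩ : Nonempty ((Cardinal.mk ι).ord.ToType ≃ ι) :=
      Cardinal.eq.1 (Cardinal.mk_ord_toType _)
    exact ⟨F ∘ e, fun i => hF _, by rwa [← e.surjective.iUnion_comp F] at hU⟩
  have hD : Cardinal.mk D ∈ S := hfam D (fun a => {a}) hsing (by
    rw [Set.iUnion_of_singleton]; exact Filter.univ_mem)
  obtain ⟨μ, hμ⟩ : ∃ μ, μ = sInf S := ⟨_, rfl⟩
  obtain ⟨F, hF, hFU⟩ : μ ∈ S := hμ ▸ csInf_mem ⟨_, hD⟩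
  -- Minimality of `μ`, applied to complements, is `μ`-completeness.
  have hsmall : ∀ (ι : Type u) (F : ι → Set D), Cardinal.mk ι < μ → (∀ i, F i ∈ U) →
      (⋂ i, F i) ∈ U := by
    intro ι F hι hF
    by_contra hn
    refine (hμ.trans_le <| csInf_le' (hfam ι (fun i => (F i)ᶜ) (fun i => ?_) ?_)).not_gt hι
    · exact fun h => Ultrafilter.compl_mem_iff_notMem.1 h (hF i)
    · rw [← Set.compl_iInter]
      exact Ultrafilter.compl_mem_iff_notMem.2 hn
  have hμ0 : Cardinal.aleph0 < μ := by
    by_contra! hle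
    have : Countable μ.ord.ToType := by
      rw [← Cardinal.mk_le_aleph0_iff, Cardinal.mk_ord_toType]
      exact hle
    have h1 : (⋂ i, (F i)ᶜ) ∈ (U : Filter D) :=
      countable_iInter_mem.2 fun i => Ultrafilter.compl_mem_iff_notMem.2 (hF i)
    rw [← Set.compl_iUnion] at h1
    exact Ultrafilter.compl_mem_iff_notMem.1 h1 hFU
  have hne : Nonempty μ.ord.ToType := by
    rw [← Cardinal.mk_ne_zero_iff, Cardinal.mk_ord_toType]
    exact (Cardinal.aleph0_pos.trans hμ0).ne'
  -- Points of the union are sent to a piece containing them; the other points form a `U`-null set,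
  -- so their image is arbitrary.
  have hg : ∀ x, ∃ i, x ∈ ⋃ i, F i → x ∈ F i := by
    intro x
    by_cases hx : x ∈ ⋃ i, F i
    · obtain ⟨i, hi⟩ := Set.mem_iUnion.1 hx
      exact ⟨i, fun _ => hi⟩
    · exact ⟨Classical.arbitrary _, fun h => absurd h hx⟩
  choose g hg using hg
  -- The pushforward along `g` makes `μ` measurable, although `μ ≤ #D`. It is nonprincipal because,
  -- on the union, the preimage of `i` lies in `F i ∉ U`.
  refine (hmeas μ ⟨hμ0, U.map g, fun i hi => ?_, ⟨fun T hT hTU => ?_⟩⟩).not_ge (hμ.trans_le <| csInf_le' hD)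
  · refine hF i (Filter.mem_of_superset (Filter.inter_mem (Ultrafilter.mem_map.1 hi) hFU) ?_)
    rintro x ⟨hx, hxU⟩
    have hx' : g x = i := hx
    exact hx' ▸ hg x hxU
  · refine Ultrafilter.mem_map.2 ?_
    rw [Set.sInter_eq_iInter, Set.preimage_iInter]
    exact hsmall T _ hT fun s => Ultrafilter.mem_map.1 (hTU s s.2)

/-! ### Atomic conditions and moduli of continuity. -/

/-- A single monadic predicate symbol. -/
inductive UnSym : ℕ → Type u
  | P : UnSym 1

theorem exists_rat_pos_le_one_lt {ε : ℝ} (hε : 0 < ε) :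
    ∃ r : ℚ, 0 < r ∧ r ≤ 1 ∧ (r : ℝ) < ε := by
  obtain ⟨r, h0, h1⟩ := exists_rat_btwn (lt_min hε one_pos)
  refine ⟨r, by exact_mod_cast h0, ?_, h1.trans_le (min_le_left _ _)⟩
  exact_mod_cast (h1.trans_le (min_le_right _ _)).le

/-- The closed term obtained by applying a symbol of `L` to fresh constants. -/
def fnTerm {L : FirstOrder.Language.{u, u}} {C : Type u} {n : ℕ} (g : L.Functions n)
    (c : Fin n → C) : (withConsts L C).Term Empty :=
  .func (Sum.inl g) fun k => constTerm L (c k)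

namespace MetricStr

variable {L : FirstOrder.Language.{u, u}} {C : Type u}

theorem term_constTerm (M : MetricStr L) (x : C → M.carrier) (c : C) :
    (M.addConsts x).term (constTerm L c) = x c := rfl

theorem term_fnTerm (M : MetricStr L) (x : C → M.carrier) {n : ℕ} (g : L.Functions n)
    (c : Fin n → C) : (M.addConsts x).term (fnTerm g c) = M.fn g fun k => x (c k) := rfl

end MetricStr

namespace MetricValuedLogic

variable {ℒ : MetricValuedLogic.{u, v}} {L : FirstOrder.Language.{u, u}}

theorem definable_const (hℒ : ℒ.IsLogicForMetricStructures) {r : ℚ} (h0 : 0 ≤ r) (h1 : r ≤ 1) :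
    ℒ.Definable fun _ : MetricStr L => (r : ℝ) :=
  hℒ.const L r h0 h1

theorem definable_dist (hℒ : ℒ.IsLogicForMetricStructures) (s t : L.Term Empty) :
    ℒ.Definable fun M => dist (M.term s) (M.term t) :=
  hℒ.atomic_dist s t

theorem definable_pred (hℒ : ℒ.IsLogicForMetricStructures) {n : ℕ} (P : L.Relations n)
    (t : Fin n → L.Term Empty) :
    ℒ.Definable fun M => (M.pred P fun k => M.term (t k) : ℝ) := by
  obtain ⟨χ, hχ⟩ := hℒ.atomic_pred P t
  exact ⟨χ, fun M hM => by rw [hχ M hM]⟩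

theorem expressible_pred_eq_zero (hℒ : ℒ.IsLogicForMetricStructures) {n : ℕ} (P : L.Relations n)
    (t : Fin n → L.Term Empty) (K : MetricStr L → Prop) :
    ℒ.Expressible K fun M => (M.pred P fun k => M.term (t k)) = 0 := by
  refine ((definable_pred hℒ P t).le hℒ (definable_const hℒ le_rfl zero_le_one) K).congr
    fun M _ _ => ?_
  rw [Rat.cast_zero, ← Set.Icc.coe_zero (R := ℝ), Subtype.coe_le_coe]
  exact le_bot_iff

theorem expressible_pred_eq_one (hℒ : ℒ.IsLogicForMetricStructures) {n : ℕ} (P : L.Relations n)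
    (t : Fin n → L.Term Empty) (K : MetricStr L → Prop) :
    ℒ.Expressible K fun M => (M.pred P fun k => M.term (t k)) = 1 := by
  refine ((definable_const hℒ zero_le_one le_rfl).le hℒ (definable_pred hℒ P t) K).congr
    fun M _ _ => ?_
  rw [Rat.cast_one, ← Set.Icc.coe_one (R := ℝ), Subtype.coe_le_coe]
  exact top_le_iff

/-- For the maximum metric the condition is a finite disjunction over coordinates. Positivity of `r`
covers the empty tuple, where the distance is `0` and there is no coordinate. -/
theorem expressible_le_dist_tuple (hℒ : ℒ.IsLogicForMetricStructures) {n : ℕ}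
    (s t : Fin n → L.Term Empty) {r : ℚ} (h0 : 0 < r) (h1 : r ≤ 1) (K : MetricStr L → Prop) :
    ℒ.Expressible K fun M => (r : ℝ) ≤ dist (fun k => M.term (s k)) fun k => M.term (t k) := by
  refine (Expressible.exists_mem hℒ (fun k => (definable_const hℒ h0.le h1).le hℒ
    (definable_dist hℒ (s k) (t k)) K) Finset.univ).congr fun M _ _ => ?_
  have h0' : (0 : ℝ) < r := by exact_mod_cast h0
  rw [← not_lt, dist_pi_lt_iff h0']
  simp

/-- The modulus condition in disjunctive form; the pair `x, y` is quantified as a single tuple of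
length `n + n`. -/
theorem expressible_fn_modulus (hℒ : ℒ.IsLogicForMetricStructures) {n : ℕ} (g : L.Functions n)
    {ε δ : ℚ} (hε : 0 ≤ ε) (hε1 : ε ≤ 1) (hδ : 0 < δ) (hδ1 : δ ≤ 1) :
    ℒ.Expressible (fun _ => True) fun M => ∀ x y : Fin n → M.carrier,
      dist (M.fn g x) (M.fn g y) ≤ ε ∨ (δ : ℝ) ≤ dist x y := by
  have h := ((definable_dist hℒ (fnTerm g fun k => ULift.up (Fin.castAdd n k))
    (fnTerm g fun k => ULift.up (Fin.natAdd n k))).le hℒ (definable_const hℒ hε hε1)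
      fun _ => True).or hℒ (expressible_le_dist_tuple hℒ
      (fun k => constTerm L (ULift.up (Fin.castAdd n k)))
      (fun k => constTerm L (ULift.up (Fin.natAdd n k))) hδ hδ1 fun _ => True)
  refine (Expressible.forall_fin hℒ h).congr fun M _ _ => ?_
  simp only [MetricStr.term_constTerm, MetricStr.term_fnTerm]
  constructor
  · intro H x y
    simpa only [Fin.append_left, Fin.append_right] using H (Fin.append x y)
  · intro H x
    exact H _ _

theorem expressible_pred_modulus (hℒ : ℒ.IsLogicForMetricStructures) {n : ℕ} (P : L.Relations n)
    {ε δ : ℚ} (hε : 0 ≤ ε) (hε1 : ε ≤ 1) (hδ : 0 < δ) (hδ1 : δ ≤ 1) :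
    ℒ.Expressible (fun _ => True) fun M => ∀ x y : Fin n → M.carrier,
      (M.pred P x : ℝ) ≤ M.pred P y + ε ∨ (δ : ℝ) ≤ dist x y := by
  have h := ((definable_pred hℒ (L := withConsts L (ULift.{u} (Fin (n + n)))) P
    fun k => constTerm L (ULift.up (Fin.castAdd n k))).le hℒ
      ((definable_pred hℒ (L := withConsts L (ULift.{u} (Fin (n + n)))) P
        fun k => constTerm L (ULift.up (Fin.natAdd n k))).add_const hℒ hε hε1)
      fun _ => True).or hℒ (expressible_le_dist_tuple hℒ
      (fun k => constTerm L (ULift.up (Fin.castAdd n k)))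
      (fun k => constTerm L (ULift.up (Fin.natAdd n k))) hδ hδ1 fun _ => True)
  refine (Expressible.forall_fin hℒ h).congr fun M _ _ => ?_
  simp only [MetricStr.term_constTerm]
  have hP : ∀ x : Fin n → M.carrier, (M.pred P x : ℝ) ≤ 1 := fun x => (M.pred P x).2.2
  constructor
  · intro H x y
    have := H (Fin.append x y)
    simp only [Fin.append_left, Fin.append_right] at this
    exact this.imp_left fun h => h.trans (min_le_left _ _)
  · intro H x
    exact (H _ _).imp_left fun h => le_min h (hP _)

/-! ### The common theory of a family of structures. -/

variable (ℒ) in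
/-- The sentences of value `1` in all structures of a family. -/
def fullTheory {J : Type w} (N : J → MetricStr L) : Set (ℒ.Sent L) :=
  {χ | ∀ j, ℒ.val (N j) χ = 1}

theorem models_fullTheory {J : Type w} {N : J → MetricStr L} (hN : ∀ j, ℒ.Mem (N j)) (j : J) :
    ℒ.Models (ℒ.fullTheory N) (N j) :=
  ⟨hN j, fun _ hφ => hφ j⟩

/-- The sentence expressing `Q` holds in the whole family, so it belongs to the theory. -/
theorem Expressible.transfer {K Q : MetricStr L → Prop} (h : ℒ.Expressible K Q) {J : Type w}
    {N : J → MetricStr L} (hN : ∀ j, ℒ.Mem (N j)) (hK : ∀ j, K (N j)) (hQ : ∀ j, Q (N j))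
    {M : MetricStr L} (hM : ℒ.Models (ℒ.fullTheory N) M) (hKM : K M) : Q M := by
  obtain ⟨χ, hχ⟩ := h
  exact (hχ M hM.1 hKM).1 (hM.2 χ fun j => (hχ _ (hN j) (hK j)).2 (hQ j))

/-- A modulus common to the family passes to all models, since its instances at rational `ε` and `δ`
are expressible. Rounding to rationals below the given reals loses nothing. -/
theorem uniform_fullTheory (hℒ : ℒ.IsLogicForMetricStructures) {J : Type w}
    {N : J → MetricStr L} (hN : ∀ j, ℒ.Mem (N j))
    (hfn : ∀ (n : ℕ) (g : L.Functions n), ∀ ε > 0, ∃ δ > 0, ∀ j, ∀ x y : Fin n → (N j).carrier,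
      dist x y < δ → dist ((N j).fn g x) ((N j).fn g y) ≤ ε)
    (hpred : ∀ (n : ℕ) (P : L.Relations n), ∀ ε > 0, ∃ δ > 0, ∀ j,
      ∀ x y : Fin n → (N j).carrier, dist x y < δ → dist ((N j).pred P x) ((N j).pred P y) ≤ ε) :
    ℒ.Uniform (ℒ.fullTheory N) := by
  have choice : ∀ p : ℝ → ℝ → Prop, (∀ ε > 0, ∃ δ > 0, p ε δ) →
      ∃ Δ : ℝ → ℝ, (∀ ε > 0, 0 < Δ ε) ∧ ∀ ε > 0, p ε (Δ ε) := by
    intro p hp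
    choose! Δ h0 h1 using hp
    exact ⟨Δ, h0, h1⟩
  constructor
  · intro n g
    obtain ⟨Δ, h0, h1⟩ := choice (fun ε δ => ∀ M, ℒ.Models (ℒ.fullTheory N) M →
      ∀ x y : Fin n → M.carrier, dist x y < δ → dist (M.fn g x) (M.fn g y) ≤ ε) (by
        intro ε hε
        obtain ⟨r, hr0, hr1, hr⟩ := exists_rat_pos_le_one_lt hε
        obtain ⟨δ, hδ, H⟩ := hfn n g r (by exact_mod_cast hr0)
        obtain ⟨s, hs0, hs1, hs⟩ := exists_rat_pos_le_one_lt hδ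
        refine ⟨s, by exact_mod_cast hs0, fun M hM x y hxy => ?_⟩
        refine (((expressible_fn_modulus hℒ g hr0.le hr1 hs0 hs1).transfer hN (fun _ => trivial)
          (fun j x y => ?_) hM trivial x y).resolve_right hxy.not_ge).trans hr.le
        rw [or_iff_not_imp_right, not_le]
        exact fun h => H j x y (h.trans hs))
    exact ⟨Δ, h0, fun M hM ε hε => h1 ε hε M hM⟩
  · intro n P
    obtain ⟨Δ, h0, h1⟩ := choice (fun ε δ => ∀ M, ℒ.Models (ℒ.fullTheory N) M →
      ∀ x y : Fin n → M.carrier, dist x y < δ → dist (M.pred P x) (M.pred P y) ≤ ε) (by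
        intro ε hε
        obtain ⟨r, hr0, hr1, hr⟩ := exists_rat_pos_le_one_lt hε
        obtain ⟨δ, hδ, H⟩ := hpred n P r (by exact_mod_cast hr0)
        obtain ⟨s, hs0, hs1, hs⟩ := exists_rat_pos_le_one_lt hδ
        refine ⟨s, by exact_mod_cast hs0, fun M hM x y hxy => ?_⟩
        have key := (expressible_pred_modulus hℒ P hr0.le hr1 hs0 hs1).transfer hN
          (fun _ => trivial) (fun j x y => by
            rw [or_iff_not_imp_right, not_le]
            intro h
            have := H j x y (h.trans hs)
            rw [Subtype.dist_eq, Real.dist_eq] at this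
            linarith [le_abs_self (((N j).pred P x : ℝ) - (N j).pred P y)]) hM trivial
        have h1 := (key x y).resolve_right hxy.not_ge
        have h2 := (key y x).resolve_right (dist_comm x y ▸ hxy).not_ge
        rw [Subtype.dist_eq, Real.dist_eq, abs_le]
        constructor <;> linarith)
    exact ⟨Δ, h0, fun M hM ε hε => h1 ε hε M hM⟩

/-! ### Relativization to the fibers of a binary predicate. -/

/-- The fresh binary predicate is discrete, does not change along distances less than `1`, and its
fibers are nonempty and closed under the operations of `L`. -/
structure _root_.MetricStr.IsFibration (M : MetricStr (withBin L)) : Prop where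
  discrete : M.Discrete (binR L)
  locallyConst : ∀ a a' b, dist a a' < 1 → M.pred (binR L) ![a, b] = 1 →
    M.pred (binR L) ![a', b] = 1
  closed : ∀ b, (M.reduct (inclBin L)).ClosedSet (fiber M b)

/-- The substructure whose universe is a fiber of the fresh binary predicate. -/
abbrev _root_.MetricStr.IsFibration.part {M : MetricStr (withBin L)} (h : M.IsFibration)
    (b : M.carrier) : MetricStr L :=
  (M.reduct (inclBin L)).restrict (fiber M b) (h.closed b)

/-- Restriction is available for monadic predicates only, so `R(·, b)` is added as a new monadic
predicate in place of `R`. Local constancy is what permits this expansion. -/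
theorem mem_part (hcon : ℒ.HasStandardConstructions) {M : MetricStr (withBin L)}
    (hM : ℒ.Mem M) (h : M.IsFibration) (b : M.carrier) : ℒ.Mem (h.part b) := by
  let LP : FirstOrder.Language.{u, u} := ⟨L.Functions, fun n => L.Relations n ⊕ UnSym.{u} n⟩
  let ρ : L →ᴸ LP := ⟨fun _ g => g, fun _ P => Sum.inl P⟩
  have hρ : ρ.Injective := ⟨fun {n} => Function.injective_id, fun {n} => Sum.inl_injective⟩
  let N : MetricStr LP :=
    { carrier := M.carrier
      nonempty := M.nonempty
      metric := M.metric
      dist_le_one := M.dist_le_one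
      fn := fun {n} g => M.fn (L := withBin L) g
      pred := fun {n} P x => Sum.elim (fun Q => M.pred (L := withBin L) (Sum.inl Q) x)
        (fun c => match n, c, x with | _, .P, x => M.pred (binR L) ![x 0, b]) P
      fn_uc := fun {n} g => M.fn_uc (L := withBin L) g
      pred_uc := by
        rintro n (Q | c)
        · exact M.pred_uc (L := withBin L) (Sum.inl Q)
        · cases c
          refine (M.pred_uc (binR L)).comp (uniformContinuous_pi.2 fun k => ?_)
          refine Fin.cases ?_ (fun _ => ?_) k
          · exact Pi.uniformContinuous_proj (fun _ : Fin 1 => M.carrier) 0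
          · simpa using uniformContinuous_const }
  have hdisc : N.Discrete (n := 1) (Sum.inr .P) := fun x => h.discrete ![x 0, b]
  have hN : ℒ.Mem N := by
    refine hcon.discrete_mem ρ N hρ (fun n f => ⟨f, rfl⟩) ?_ ?_
    · rintro n (Q | c)
      · exact Or.inl ⟨Q, rfl⟩
      · cases c
        refine Or.inr ⟨hdisc, fun x y hxy => ?_⟩
        have h0 : dist (x 0) (y 0) < 1 := (dist_le_pi_dist x y 0).trans_lt hxy
        have h1 := h.locallyConst (x 0) (y 0) b h0
        have h2 := h.locallyConst (y 0) (x 0) b (by rwa [dist_comm])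
        change M.pred (binR L) ![x 0, b] = M.pred (binR L) ![y 0, b]
        rcases h.discrete ![x 0, b] with hx | hx <;> rcases h.discrete ![y 0, b] with hy | hy
        · rw [hx, hy]
        · rw [h2 hy, hy]
        · rw [h1 hx, hx]
        · rw [hx, hy]
    · exact ℒ.reduct_mem (inclBin L) M
        ⟨fun {n} => Function.injective_id, fun {n} => Sum.inl_injective⟩ hM
  have hcl : N.ClosedSet {a | N.pred (n := 1) (Sum.inr .P) ![a] = 1} := h.closed b
  exact ℒ.reduct_mem ρ _ hρ (hcon.restrict_mem N (Sum.inr .P) hcl hN hdisc)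

/-- The universal closure of the relativization `ψ(y)` given by regularity. Regularity controls `ψ`
only over suitable `R`, hence the restriction to fibrations. -/
theorem expressible_part (hℒ : ℒ.IsLogicForMetricStructures) (hreg : ℒ.IsRegular)
    (hcon : ℒ.HasStandardConstructions) (φ : ℒ.Sent L) :
    ℒ.Expressible (fun M : MetricStr (withBin L) => M.IsFibration)
      fun M => ∀ h : M.IsFibration, ∀ b, ℒ.val (h.part b) φ = 1 := by
  obtain ⟨ψ, hψ⟩ := hreg φ
  obtain ⟨χ, hχ⟩ := hℒ.all ψ
  refine ⟨χ, fun M hM h => ?_⟩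
  have hglb := hχ M hM
  have key := hψ M hM h.discrete h.closed (mem_part hcon hM h)
  constructor
  · intro h1 _ b
    rw [← key b]
    exact le_antisymm unitInterval.le_one' (h1 ▸ hglb.1 ⟨b, rfl⟩)
  · intro h1
    refine le_antisymm unitInterval.le_one' (hglb.2 ?_)
    rintro _ ⟨b, rfl⟩
    exact ((key b).trans (h1 h b)).ge

end MetricValuedLogic

namespace MetricStr

variable {L : FirstOrder.Language.{u, u}}

theorem term_pair (M : MetricStr L) (s t : L.Term Empty) :
    (fun k => M.term ((![s, t] : Fin 2 → L.Term Empty) k)) = ![M.term s, M.term t] := by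
  funext k
  fin_cases k <;> rfl

end MetricStr

namespace MetricValuedLogic

variable {ℒ : MetricValuedLogic.{u, v}} {L L' : FirstOrder.Language.{u, u}}

/-- Each clause of `IsFibration` is a universally quantified closed condition and therefore
transfers. Nonemptiness of the fibers does so because the constant `e` names a point in all of them.
-/
theorem isFibration_of_models_fullTheory (hℒ : ℒ.IsLogicForMetricStructures) {J : Type w}
    {N : J → MetricStr L'} (hN : ∀ j, ℒ.Mem (N j)) (ρ : withBin L →ᴸ L')
    (e : L'.Functions 0) (hfib : ∀ j, ((N j).reduct ρ).IsFibration)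
    (he : ∀ j b, (N j).pred (ρ.onRelation (binR L)) ![(N j).fn e Fin.elim0, b] = 1)
    {M : MetricStr L'} (hM : ℒ.Models (ℒ.fullTheory N) M) : (M.reduct ρ).IsFibration := by
  let R : L'.Relations 2 := ρ.onRelation (binR L)
  let R' (n : ℕ) : (withConsts L' (ULift.{u} (Fin n))).Relations 2 := R
  let c {n : ℕ} (k : Fin n) : (withConsts L' (ULift.{u} (Fin n))).Term Empty :=
    constTerm L' (ULift.up k)
  have hdisc : ∀ x, M.pred R x = 0 ∨ M.pred R x = 1 :=
    (((expressible_pred_eq_zero hℒ (R' 2) c (fun _ => True)).or hℒ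
      (expressible_pred_eq_one hℒ (R' 2) c (fun _ => True))).forall_fin hℒ).transfer hN
      (fun _ => trivial) (fun j x => (hfib j).discrete x) hM trivial
  have hloc : ∀ x : Fin 3 → M.carrier, (M.pred R ![x 0, x 2] = 0 ∨ M.pred R ![x 1, x 2] = 1) ∨
      ((1 : ℚ) : ℝ) ≤ dist (x 0) (x 1) := by
    refine ((((expressible_pred_eq_zero hℒ (R' 3) ![c 0, c 2] (fun _ => True)).or hℒ
      (expressible_pred_eq_one hℒ (R' 3) ![c 1, c 2] (fun _ => True))).or hℒ
      ((definable_const hℒ zero_le_one le_rfl).le hℒ (definable_dist hℒ (c 0) (c 1)) _)).forall_fin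
        hℒ |>.congr (Q' := fun M => ∀ x : Fin 3 → M.carrier,
          (M.pred R ![x 0, x 2] = 0 ∨ M.pred R ![x 1, x 2] = 1) ∨
          ((1 : ℚ) : ℝ) ≤ dist (x 0) (x 1)) ?_).transfer hN
      (fun _ => trivial) (fun j x => ?_) hM trivial
    · intro M _ _
      simp only [MetricStr.term_pair]
      rfl
    · rcases (hfib j).discrete ![x 0, x 2] with h | h
      · exact Or.inl (Or.inl h)
      · by_cases hd : dist (x 0) (x 1) < 1
        · exact Or.inl (Or.inr ((hfib j).locallyConst _ _ _ hd h))
        · right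
          rw [Rat.cast_one]
          exact not_lt.1 hd
  have hne : ∀ x : Fin 1 → M.carrier, M.pred R ![M.fn e Fin.elim0, x 0] = 1 := by
    refine ((expressible_pred_eq_one hℒ (R' 1) ![fnTerm e Fin.elim0, c 0]
      (fun _ => True)).forall_fin hℒ |>.congr (Q' := fun M => ∀ x : Fin 1 → M.carrier,
        M.pred R ![M.fn e Fin.elim0, x 0] = 1) ?_).transfer hN
      (fun _ => trivial) (fun j x => he j _) hM trivial
    intro M _ _
    simp only [MetricStr.term_pair, MetricStr.term_fnTerm]
    rw [iff_iff_eq]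
    congr! 6
  -- Coordinate `0` is the base point of the fiber; the remaining ones are the arguments of `g`.
  have hcl : ∀ (n : ℕ) (g : L.Functions n) (x : Fin (n + 1) → M.carrier),
      (∃ k ∈ Finset.univ, M.pred R ![x (Fin.succ k), x 0] = 0) ∨
        M.pred R ![M.fn (ρ.onFunction g) fun k => x k.succ, x 0] = 1 := by
    intro n g
    refine (((Expressible.exists_mem hℒ (fun k : Fin n => expressible_pred_eq_zero hℒ (R' (n + 1))
      ![c k.succ, c 0] (fun _ => True)) Finset.univ).or hℒ
      (expressible_pred_eq_one hℒ (R' (n + 1)) ![fnTerm (ρ.onFunction g)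
        (fun k => ULift.up k.succ), c 0] (fun _ => True))).forall_fin hℒ |>.congr
        (Q' := fun M => ∀ x : Fin (n + 1) → M.carrier,
          (∃ k ∈ Finset.univ, M.pred R ![x (Fin.succ k), x 0] = 0) ∨
          M.pred R ![M.fn (ρ.onFunction g) fun k => x k.succ, x 0] = 1) ?_).transfer hN
      (fun _ => trivial) (fun j x => ?_) hM trivial
    · intro M _ _
      simp only [MetricStr.term_pair]
      rfl
    · rw [or_iff_not_imp_left]
      intro h
      refine ((hfib j).closed (x 0)).2 g _ fun k => ?_
      by_contra hk
      exact h ⟨k, Finset.mem_univ _, ((hfib j).discrete _).resolve_right hk⟩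
  refine ⟨hdisc, fun a a' b hd h => ?_, fun b => ⟨⟨_, hne fun _ => b⟩, fun {n} g x hx => ?_⟩⟩
  · refine ((hloc ![a, a', b]).resolve_right ?_).resolve_left fun h0 => ?_
    · rw [Rat.cast_one]
      exact not_le.2 hd
    · exact zero_ne_one (h0.symm.trans h)
  · refine (hcl n g (Fin.cons b x)).resolve_left ?_
    rintro ⟨k, -, hk⟩
    exact zero_ne_one (hk.symm.trans (hx k))

end MetricValuedLogic

/-! ### The disjoint sums indexed by functions `D → ℕ`. -/

theorem DisjSum.dist_extend_le {I : Type u} {C : I → Type u} [∀ i, MetricSpace (C i)] {n : ℕ}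
    {Z : Type w} [PseudoMetricSpace Z] (h1 : ∀ i, ∀ x y : C i, dist x y ≤ 1)
    (i : I) (F : (Fin n → C i) → Z) (o : Z) {ε δ : ℝ} (hε : 0 ≤ ε) (hδ : 0 < δ)
    (hF : ∀ x y, dist x y < δ → dist (F x) (F y) ≤ ε) (x y : Fin n → Σ i, C i) :
    let := sumMetric h1
    dist x y < min δ 1 → dist (extend i F o x) (extend i F o y) ≤ ε := by
  intro _ hxy
  have hk := (dist_pi_lt_iff (lt_min hδ one_pos)).1 hxy
  have hfst : ∀ k, (x k).1 = (y k).1 := fun k =>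
    fst_eq_of_dist_lt (lt_of_lt_of_le (hk k) (min_le_right _ _))
  by_cases hx : ∀ k, (x k).1 = i
  · obtain ⟨x', rfl⟩ := exists_mk i x hx
    obtain ⟨y', rfl⟩ := exists_mk i y fun k => (hfst k).symm.trans (hx k)
    rw [extend_mk, extend_mk]
    refine hF _ _ ((dist_pi_lt_iff hδ).2 fun k => ?_)
    have h2 : sumDist (⟨i, x' k⟩ : Σ i, C i) ⟨i, y' k⟩ < min δ 1 := hk k
    rw [sumDist_same] at h2
    exact lt_of_lt_of_le h2 (min_le_left _ _)
  · rw [extend_of_not i F o x hx, extend_of_not i F o y fun h => hx fun k => (hfst k).trans (h k),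
      dist_self]
    exact hε

/-- Predicate symbols for the summands of a sum indexed by `D → ℕ`, and propositional symbols
for the subsets of `D`. -/
inductive SumRel (D : Type u) : ℕ → Type u
  | part : (D → ℕ) → SumRel D 2
  | mem : Set D → SumRel D 0

/-- The vocabulary with disjoint copies of `L` indexed by `D → ℕ`, with constants indexed by
`D` and by `D → ℕ`, with predicates for the summands, and with a proposition for each subset
of `D`. -/
abbrev sumVocab (L : FirstOrder.Language.{u, u}) (D : Type u) : FirstOrder.Language.{u, u} :=
  ⟨fun n => (Σ _ : D → ℕ, L.Functions n) ⊕ ConstSym (D ⊕ (D → ℕ)) n,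
    fun n => (Σ _ : D → ℕ, L.Relations n) ⊕ SumRel D n⟩

/-- The inclusion of `L` as the copy with index `f`, with the fresh binary predicate symbol
denoting the `f`-th summand. -/
abbrev partHom (L : FirstOrder.Language.{u, u}) {D : Type u} (f : D → ℕ) :
    withBin L →ᴸ sumVocab L D where
  onFunction := fun _ g => Sum.inl ⟨f, g⟩
  onRelation := fun _ P => Sum.elim (fun Q => Sum.inl ⟨f, Q⟩)
    (fun r => match r with | .R => Sum.inr (.part f)) P

theorem partHom_injective (L : FirstOrder.Language.{u, u}) {D : Type u} (f : D → ℕ) :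
    (partHom L f).Injective := by
  refine ⟨fun {n} g g' h => ?_, fun {n} => ?_⟩
  · have h' : (Sum.inl ⟨f, g⟩ : (sumVocab L D).Functions n) = Sum.inl ⟨f, g'⟩ := h
    exact sigma_mk_injective (β := fun _ : D → ℕ => L.Functions n) (Sum.inl_injective h')
  · rintro (P | ⟨⟨⟩⟩) (Q | Q) h
    · have h' : (Sum.inl ⟨f, P⟩ : (sumVocab L D).Relations n) = Sum.inl ⟨f, Q⟩ := h
      exact congrArg Sum.inl
        (sigma_mk_injective (β := fun _ : D → ℕ => L.Relations n) (Sum.inl_injective h'))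
    · cases Q; cases h
    · cases h
    · cases Q; rfl

/-- The indicator function of a point. -/
def pointIndicator {D : Type u} [DecidableEq D] (a b : D) : ℕ := if b = a then 1 else 0

/-- Different elements of `D` thus name different summands, whose points are at distance `1`. -/
theorem pointIndicator_injective {D : Type u} [DecidableEq D] :
    Function.Injective (pointIndicator (D := D)) := by
  intro a b h
  have h1 := congrFun h a
  by_contra hne
  simp [pointIndicator, hne] at h1

section SumStr

variable {L : FirstOrder.Language.{u, u}} {D : Type u}

/-- The disjoint sum, over all `f : D → ℕ`, of the structures `A (f γ)`. -/
def baseSum (A : ℕ → MetricStr L) (γ : D) : MetricStr (sumLang fun _ : D → ℕ => L) :=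
  -- Index set and vocabulary do not depend on `γ`, so the sums for different `γ` have a common
  -- theory.
  MetricStr.sum (fun f : D → ℕ => A (f γ)) ⟨fun _ => 0, Classical.arbitrary _⟩

/-- The index of the summand of a point. -/
def summand {A : ℕ → MetricStr L} {γ : D} (a : (baseSum A γ).carrier) : D → ℕ :=
  Sigma.fst (β := fun f : D → ℕ => (A (f γ)).carrier) a

/-- The inclusion of a summand. -/
def inSummand (A : ℕ → MetricStr L) (γ : D) (f : D → ℕ) (a : (A (f γ)).carrier) :
    (baseSum A γ).carrier :=
  Sigma.mk (β := fun f : D → ℕ => (A (f γ)).carrier) f a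

theorem inSummand_injective (A : ℕ → MetricStr L) (γ : D) (f : D → ℕ) :
    Function.Injective (inSummand A γ f) :=
  sigma_mk_injective (β := fun f : D → ℕ => (A (f γ)).carrier)

theorem exists_inSummand {A : ℕ → MetricStr L} {γ : D} {f : D → ℕ} {a : (baseSum A γ).carrier}
    (h : summand a = f) : ∃ a', inSummand A γ f a' = a := by
  obtain ⟨f', a'⟩ := a
  obtain rfl : f' = f := h
  exact ⟨a', rfl⟩

theorem dist_inSummand (A : ℕ → MetricStr L) (γ : D) (f : D → ℕ) (a b : (A (f γ)).carrier) :
    dist (inSummand A γ f a) (inSummand A γ f b) = dist a b :=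
  DisjSum.sumDist_same (C := fun f : D → ℕ => (A (f γ)).carrier) f a b

theorem dist_of_summand_ne {A : ℕ → MetricStr L} {γ : D} {a b : (baseSum A γ).carrier}
    (h : summand a ≠ summand b) : dist a b = 1 :=
  DisjSum.sumDist_ne (C := fun f : D → ℕ => (A (f γ)).carrier) h

theorem baseSum_fn (A : ℕ → MetricStr L) (γ : D) (f : D → ℕ) {n : ℕ} (g : L.Functions n)
    (x : Fin n → (A (f γ)).carrier) :
    (baseSum A γ).fn ⟨f, g⟩ (fun k => inSummand A γ f (x k)) =
      inSummand A γ f ((A (f γ)).fn g x) :=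
  DisjSum.extend_mk (C := fun f : D → ℕ => (A (f γ)).carrier) (Z := (baseSum A γ).carrier) f
    (fun x => inSummand A γ f ((A (f γ)).fn g x)) _ x

theorem baseSum_pred (A : ℕ → MetricStr L) (γ : D) (f : D → ℕ) {n : ℕ} (P : L.Relations n)
    (x : Fin n → (A (f γ)).carrier) :
    (baseSum A γ).pred ⟨f, P⟩ (fun k => inSummand A γ f (x k)) = (A (f γ)).pred P x :=
  DisjSum.extend_mk (C := fun f : D → ℕ => (A (f γ)).carrier) f _ _ x

theorem baseSum_fn_modulus (A : ℕ → MetricStr L) (γ : D) (f : D → ℕ) {n : ℕ} (g : L.Functions n)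
    {ε δ : ℝ} (hε : 0 ≤ ε) (hδ : 0 < δ)
    (h : ∀ x y, dist x y < δ → dist ((A (f γ)).fn g x) ((A (f γ)).fn g y) ≤ ε)
    (x y : Fin n → (baseSum A γ).carrier) (hxy : dist x y < min δ 1) :
    dist ((baseSum A γ).fn ⟨f, g⟩ x) ((baseSum A γ).fn ⟨f, g⟩ y) ≤ ε :=
  DisjSum.dist_extend_le (C := fun f : D → ℕ => (A (f γ)).carrier) (Z := (baseSum A γ).carrier)
    (fun f => (A (f γ)).dist_le_one) f (fun x => inSummand A γ f ((A (f γ)).fn g x)) _ hε hδ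
    (fun x y hd => (dist_inSummand A γ f _ _).trans_le (h x y hd)) x y hxy

theorem baseSum_pred_modulus (A : ℕ → MetricStr L) (γ : D) (f : D → ℕ) {n : ℕ}
    (P : L.Relations n) {ε δ : ℝ} (hε : 0 ≤ ε) (hδ : 0 < δ)
    (h : ∀ x y, dist x y < δ → dist ((A (f γ)).pred P x) ((A (f γ)).pred P y) ≤ ε)
    (x y : Fin n → (baseSum A γ).carrier) (hxy : dist x y < min δ 1) :
    dist ((baseSum A γ).pred ⟨f, P⟩ x) ((baseSum A γ).pred ⟨f, P⟩ y) ≤ ε :=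
  DisjSum.dist_extend_le (C := fun f : D → ℕ => (A (f γ)).carrier)
    (fun f => (A (f γ)).dist_le_one) f _ _ hε hδ h x y hxy

/-- A point of the summand with index `f`. -/
def basePoint (A : ℕ → MetricStr L) (γ : D) (f : D → ℕ) : (baseSum A γ).carrier :=
  inSummand A γ f (Classical.arbitrary _)

open Classical in
/-- The denotation of the discrete predicates. -/
def sumPred {A : ℕ → MetricStr L} {γ : D} {n : ℕ} (r : SumRel D n)
    (x : Fin n → (baseSum A γ).carrier) : unitInterval :=
  match n, r, x with
  | _, .part f, x => if summand (x 0) = f then 1 else 0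
  | _, .mem S, _ => if γ ∈ S then 1 else 0

theorem sumPred_discrete {A : ℕ → MetricStr L} {γ : D} {n : ℕ} (r : SumRel D n)
    (x : Fin n → (baseSum A γ).carrier) : sumPred r x = 0 ∨ sumPred r x = 1 := by
  cases r <;> simp only [sumPred] <;> split_ifs <;> simp

theorem sumPred_congr {A : ℕ → MetricStr L} {γ : D} {n : ℕ} (r : SumRel D n)
    (x y : Fin n → (baseSum A γ).carrier) (h : dist x y < 1) : sumPred r x = sumPred r y := by
  cases r
  · have h0 : summand (x 0) = summand (y 0) := by
      by_contra hne
      exact ((dist_le_pi_dist x y 0).trans_lt h).ne (dist_of_summand_ne hne)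
    simp only [sumPred]
    rw [h0]
  · rfl

variable [LinearOrder D]

/-- The denotation of the constants: the constant `f : D → ℕ` denotes a point of the `f`-th
summand, and the constants indexed by `D` form a sequence that is stationary from `γ` on and
consists of points of different summands before that. -/
def sumConst (A : ℕ → MetricStr L) (γ : D) : D ⊕ (D → ℕ) → (baseSum A γ).carrier
  | .inl a => basePoint A γ (pointIndicator (min a γ))
  | .inr f => basePoint A γ f

/-- The expansion of the disjoint sum, over all `f : D → ℕ`, of the structures `A (f γ)`. -/
abbrev sumStr (A : ℕ → MetricStr L) (γ : D) : MetricStr (sumVocab L D) where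
  carrier := (baseSum A γ).carrier
  nonempty := (baseSum A γ).nonempty
  metric := (baseSum A γ).metric
  dist_le_one := (baseSum A γ).dist_le_one
  fn := fun g x => Sum.elim (fun g => (baseSum A γ).fn g x)
    (fun c => match c with | .c i => sumConst A γ i) g
  pred := fun P x => Sum.elim (fun P => (baseSum A γ).pred P x) (fun r => sumPred r x) P
  fn_uc := by
    rintro n (g | c)
    · exact (baseSum A γ).fn_uc g
    · cases c
      exact uniformContinuous_const
  pred_uc := by
    rintro n (P | r)
    · exact (baseSum A γ).pred_uc P
    · refine Metric.uniformContinuous_iff.2 fun ε hε => ⟨1, one_pos, fun {x y} hxy => ?_⟩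
      have h := sumPred_congr r x y hxy
      change dist (sumPred r x) (sumPred r y) < ε
      rw [h, dist_self]
      exact hε

variable {ℒ : MetricValuedLogic.{u, v}}

/-- The sum is built by three closure properties in turn: disjoint sum, constants (giving the
vocabulary `L₁`), discrete predicates. -/
theorem mem_sumStr (hℒ : ℒ.IsLogicForMetricStructures) (hcon : ℒ.HasStandardConstructions)
    {A : ℕ → MetricStr L} (hA : ∀ n, ℒ.Mem (A n)) (γ : D) : ℒ.Mem (sumStr A γ) := by
  let L₁ : FirstOrder.Language.{u, u} :=
    ⟨(sumVocab L D).Functions, fun n => Σ _ : D → ℕ, L.Relations n⟩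
  let ρ₁ : L₁ →ᴸ sumVocab L D := ⟨fun _ g => g, fun _ P => Sum.inl P⟩
  let ρ₀ : (sumLang fun _ : D → ℕ => L) →ᴸ L₁ := ⟨fun _ g => Sum.inl g, fun _ P => P⟩
  refine hcon.discrete_mem ρ₁ (sumStr A γ)
    ⟨fun {n} => Function.injective_id, fun {n} => Sum.inl_injective⟩ (fun n g => ⟨g, rfl⟩) ?_ ?_
  · rintro n (P | r)
    · exact Or.inl ⟨P, rfl⟩
    · exact Or.inr ⟨sumPred_discrete r, sumPred_congr r⟩
  · refine hℒ.constants_mem ρ₀ _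
      ⟨fun {n} => Sum.inl_injective, fun {n} => Function.injective_id⟩ ?_ (fun n P => ⟨P, rfl⟩) ?_
    · rintro n (g | c)
      · exact ⟨g, rfl⟩
      · exact nomatch c
    · exact hcon.sum_mem (fun f : D → ℕ => A (f γ)) _ fun f => hA _

theorem mem_fiber_sumStr {A : ℕ → MetricStr L} {γ : D} {f : D → ℕ}
    {a b : (sumStr A γ).carrier} :
    a ∈ MetricValuedLogic.fiber ((sumStr A γ).reduct (partHom L f)) b ↔ summand a = f := by
  classical
  change (if summand a = f then (1 : unitInterval) else 0) = 1 ↔ summand a = f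
  split_ifs with h <;> simp [h]

theorem isFibration_sumStr (A : ℕ → MetricStr L) (γ : D) (f : D → ℕ) :
    ((sumStr A γ).reduct (partHom L f)).IsFibration where
  discrete := sumPred_discrete (.part f)
  locallyConst := by
    intro a a' b hd h
    rw [← h]
    refine (sumPred_congr (.part f) ![a, b] ![a', b] ?_).symm
    refine (dist_pi_lt_iff one_pos).2 fun k => ?_
    refine Fin.cases hd (fun k => ?_) k
    simp
  closed := by
    intro b
    refine ⟨⟨basePoint A γ f, mem_fiber_sumStr.2 rfl⟩, fun {n} g x hx => ?_⟩
    choose x' hx' using fun k => exists_inSummand (mem_fiber_sumStr.1 (hx k))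
    obtain rfl : (fun k => inSummand A γ f (x' k)) = x := funext hx'
    exact mem_fiber_sumStr.2 (congrArg summand (baseSum_fn A γ f g x'))

/-- The `f`-th part of the sum is `A (f γ)`. -/
def partIso (A : ℕ → MetricStr L) (γ : D) (f : D → ℕ)
    (h : ((sumStr A γ).reduct (partHom L f)).IsFibration) (b : (sumStr A γ).carrier) :
    (A (f γ)).Iso (h.part b) where
  toEquiv := Equiv.ofBijective (fun a => ⟨inSummand A γ f a, mem_fiber_sumStr.2 rfl⟩) (by
    constructor
    · intro a a' haa
      exact inSummand_injective A γ f (congrArg Subtype.val haa)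
    · rintro ⟨a, ha⟩
      obtain ⟨a', rfl⟩ := exists_inSummand (mem_fiber_sumStr.1 ha)
      exact ⟨a', rfl⟩)
  dist_eq := fun x y => dist_inSummand A γ f x y
  map_fn := fun {n} g x => Subtype.ext (baseSum_fn A γ f g x).symm
  map_pred := fun {n} P x => (baseSum_pred A γ f P x).symm

/-- All summands, for all `γ`, are models of `T`, so the moduli of `T`, cut off at `1`, serve every
sum. Below distance `1` the new symbols do not vary. -/
theorem uniform_sumStr (hℒ : ℒ.IsLogicForMetricStructures) (hcon : ℒ.HasStandardConstructions)
    {T : Set (ℒ.Sent L)} (hT : ℒ.Uniform T) {A : ℕ → MetricStr L} (hA : ∀ n, ℒ.Models T (A n)) :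
    ℒ.Uniform (ℒ.fullTheory (sumStr A : D → MetricStr (sumVocab L D))) := by
  refine MetricValuedLogic.uniform_fullTheory hℒ (mem_sumStr hℒ hcon fun n => (hA n).1) ?_ ?_
  · rintro n (⟨f, g⟩ | c) ε hε
    · obtain ⟨Δ, h0, h1⟩ := hT.1 n g
      refine ⟨min (Δ ε) 1, lt_min (h0 ε hε) one_pos, fun γ x y => ?_⟩
      exact baseSum_fn_modulus A γ f g hε.le (h0 ε hε) (h1 _ (hA _) ε hε) x y
    · cases c
      exact ⟨1, one_pos, fun γ x y _ => (dist_self _).trans_le hε.le⟩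
  · rintro n (⟨f, P⟩ | r) ε hε
    · obtain ⟨Δ, h0, h1⟩ := hT.2 n P
      refine ⟨min (Δ ε) 1, lt_min (h0 ε hε) one_pos, fun γ x y => ?_⟩
      exact baseSum_pred_modulus A γ f P hε.le (h0 ε hε) (h1 _ (hA _) ε hε) x y
    · refine ⟨1, one_pos, fun γ x y hxy => ?_⟩
      change dist (sumPred r x) (sumPred r y) ≤ ε
      rw [sumPred_congr r x y hxy, dist_self]
      exact hε.le

end SumStr

/-! ### Metastability and Cauchy nets. -/

namespace MetricValuedLogic

section Sampling

variable {ℒ : MetricValuedLogic.{u, v}} {L : FirstOrder.Language.{u, u}} {D : Type w}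
  [PartialOrder D] {T : Set (ℒ.Sent L)} {t : D → L.Term Empty}

/-- If the net is not Cauchy in some model, a sampling that picks a pair at distance `> ε` beyond
each `i` defeats every choice of `E`. -/
theorem UniformlyMetastableModulo.cauchyModulo (h : ℒ.UniformlyMetastableModulo T t) :
    ℒ.CauchyModulo T t := by
  classical
  intro M hM ε hε
  by_contra! hn
  choose j k hj hk hjk using hn
  obtain ⟨E, -, hE⟩ := h
  obtain ⟨i, -, hi⟩ := hE M hM ε hε
    ⟨fun i => {j i, k i}, fun i => ⟨j i, by simp⟩, fun i l hl => by
      rcases Finset.mem_insert.1 hl with rfl | hl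
      · exact hj i
      · rw [Finset.mem_singleton.1 hl]
        exact hk i⟩
  exact (hi (j i) (by simp) (k i) (by simp)).not_gt (hjk i)

/-- A rate is merely a choice of one finite set per pair `(ε, η)`, so its absence is witnessed by a
single pair. -/
theorem exists_models_of_not_uniformlyMetastableModulo
    (h : ¬ ℒ.UniformlyMetastableModulo T t) :
    ∃ ε > 0, ∃ η : Sampling D, ∀ E : Finset D, E.Nonempty → ∃ M, ℒ.Models T M ∧
      ∀ i ∈ E, ∃ j ∈ η.set i, ∃ k ∈ η.set i, ε < dist (M.term (t j)) (M.term (t k)) := by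
  by_contra! hn
  have h' : ∀ (ε : ℝ) (η : Sampling D), ∃ E : Finset D, 0 < ε → E.Nonempty ∧
      ∀ M, ℒ.Models T M → ∃ i ∈ E, ∀ j ∈ η.set i, ∀ k ∈ η.set i,
        dist (M.term (t j)) (M.term (t k)) ≤ ε := by
    intro ε η
    by_cases hε : 0 < ε
    · obtain ⟨E, hE⟩ := hn ε hε η
      exact ⟨E, fun _ => hE⟩
    · exact ⟨∅, fun h => absurd h hε⟩
  choose E hE using h'
  exact h ⟨E, fun ε hε η => (hE ε η hε).1, fun M hM ε hε η => (hE ε η hε).2 M hM⟩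

end Sampling

/-! ### Models of the common theory of the sums. -/

variable {ℒ : MetricValuedLogic.{u, v}} {L : FirstOrder.Language.{u, u}} {D : Type u}

/-- The closed term consisting of a constant indexed by `D`. -/
def seqTerm (L : FirstOrder.Language.{u, u}) {D : Type u} (a : D) : (sumVocab L D).Term Empty :=
  .func (Sum.inr (.c (.inl a))) Fin.elim0

/-- The truth value of the proposition associated with `S`. -/
def subsetVal (M : MetricStr (sumVocab L D)) (S : Set D) : unitInterval :=
  M.pred (Sum.inr (SumRel.mem S)) Fin.elim0

theorem expressible_subsetVal_eq_zero (hℒ : ℒ.IsLogicForMetricStructures) (S : Set D)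
    (K : MetricStr (sumVocab L D) → Prop) : ℒ.Expressible K fun M => subsetVal M S = 0 := by
  refine (expressible_pred_eq_zero hℒ (Sum.inr (SumRel.mem S)) Fin.elim0 K).congr fun M _ _ => ?_
  rw [subsetVal, Subsingleton.elim (fun k => M.term (Fin.elim0 k)) Fin.elim0]

theorem expressible_subsetVal_eq_one (hℒ : ℒ.IsLogicForMetricStructures) (S : Set D)
    (K : MetricStr (sumVocab L D) → Prop) : ℒ.Expressible K fun M => subsetVal M S = 1 := by
  refine (expressible_pred_eq_one hℒ (Sum.inr (SumRel.mem S)) Fin.elim0 K).congr fun M _ _ => ?_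
  rw [subsetVal, Subsingleton.elim (fun k => M.term (Fin.elim0 k)) Fin.elim0]

variable [LinearOrder D]

theorem term_seqTerm (A : ℕ → MetricStr L) (γ a : D) :
    (sumStr A γ).term (seqTerm L a) = basePoint A γ (pointIndicator (min a γ)) := rfl

theorem subsetVal_sumStr_eq_one {A : ℕ → MetricStr L} {γ : D} {S : Set D} (h : γ ∈ S) :
    subsetVal (sumStr A γ) S = 1 :=
  if_pos h

theorem subsetVal_sumStr_eq_zero {A : ℕ → MetricStr L} {γ : D} {S : Set D} (h : γ ∉ S) :
    subsetVal (sumStr A γ) S = 0 :=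
  if_neg h

section Model

variable {A : ℕ → MetricStr L} {M : MetricStr (sumVocab L D)}

/-- In each sum the proposition of `S` says `γ ∈ S` and has value `0` or `1`. Hence Boolean laws for
subsets are disjunctions true in all sums, and they transfer to `M`. -/
theorem subsetVal_inter (hℒ : ℒ.IsLogicForMetricStructures) (hcon : ℒ.HasStandardConstructions)
    (hA : ∀ n, ℒ.Mem (A n)) (hM : ℒ.Models (ℒ.fullTheory (sumStr A : D → _)) M) {S S' : Set D}
    (h : subsetVal M S = 1) (h' : subsetVal M S' = 1) : subsetVal M (S ∩ S') = 1 := by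
  have key := (((expressible_subsetVal_eq_zero hℒ S (fun _ => True)).or hℒ
    (expressible_subsetVal_eq_zero hℒ S' _)).or hℒ
    (expressible_subsetVal_eq_one hℒ (S ∩ S') _)).transfer (mem_sumStr hℒ hcon hA)
    (fun _ => trivial) (fun γ => ?_) hM trivial
  · simpa [h, h'] using key
  · by_cases h1 : γ ∈ S
    · by_cases h2 : γ ∈ S'
      · exact Or.inr (subsetVal_sumStr_eq_one ⟨h1, h2⟩)
      · exact Or.inl (Or.inr (subsetVal_sumStr_eq_zero h2))
    · exact Or.inl (Or.inl (subsetVal_sumStr_eq_zero h1))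

theorem subsetVal_mono (hℒ : ℒ.IsLogicForMetricStructures) (hcon : ℒ.HasStandardConstructions)
    (hA : ∀ n, ℒ.Mem (A n)) (hM : ℒ.Models (ℒ.fullTheory (sumStr A : D → _)) M) {S S' : Set D}
    (h : subsetVal M S = 1) (hS : S ⊆ S') : subsetVal M S' = 1 := by
  have key := ((expressible_subsetVal_eq_zero hℒ S (fun _ => True)).or hℒ
    (expressible_subsetVal_eq_one hℒ S' _)).transfer (mem_sumStr hℒ hcon hA)
    (fun _ => trivial) (fun γ => ?_) hM trivial
  · simpa [h] using key
  · by_cases h1 : γ ∈ S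
    · exact Or.inr (subsetVal_sumStr_eq_one (hS h1))
    · exact Or.inl (subsetVal_sumStr_eq_zero h1)

theorem subsetVal_univ (hℒ : ℒ.IsLogicForMetricStructures) (hcon : ℒ.HasStandardConstructions)
    (hA : ∀ n, ℒ.Mem (A n)) (hM : ℒ.Models (ℒ.fullTheory (sumStr A : D → _)) M) :
    subsetVal M (Set.univ : Set D) = 1 :=
  (expressible_subsetVal_eq_one hℒ Set.univ (fun _ => True)).transfer (mem_sumStr hℒ hcon hA)
    (fun _ => trivial) (fun _ => subsetVal_sumStr_eq_one trivial) hM trivial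

theorem subsetVal_compl (hℒ : ℒ.IsLogicForMetricStructures) (hcon : ℒ.HasStandardConstructions)
    (hA : ∀ n, ℒ.Mem (A n)) (hM : ℒ.Models (ℒ.fullTheory (sumStr A : D → _)) M) (S : Set D) :
    subsetVal M Sᶜ = 1 ↔ subsetVal M S ≠ 1 := by
  have h1 := ((expressible_subsetVal_eq_zero hℒ S (fun _ => True)).or hℒ
    (expressible_subsetVal_eq_zero hℒ Sᶜ _)).transfer (mem_sumStr hℒ hcon hA)
    (fun _ => trivial) (fun γ => by
      by_cases h1 : γ ∈ S
      · exact Or.inr (subsetVal_sumStr_eq_zero (not_not.2 h1))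
      · exact Or.inl (subsetVal_sumStr_eq_zero h1)) hM trivial
  have h2 := ((expressible_subsetVal_eq_one hℒ S (fun _ => True)).or hℒ
    (expressible_subsetVal_eq_one hℒ Sᶜ _)).transfer (mem_sumStr hℒ hcon hA)
    (fun _ => trivial) (fun γ => by
      by_cases h1 : γ ∈ S
      · exact Or.inl (subsetVal_sumStr_eq_one h1)
      · exact Or.inr (subsetVal_sumStr_eq_one h1)) hM trivial
  constructor
  · intro h h'
    rw [h, h'] at h1
    simp at h1
  · exact h2.resolve_left

/-- The ultrafilter of the sets whose propositions hold in `M`. -/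
def subsetUltrafilter (hℒ : ℒ.IsLogicForMetricStructures) (hcon : ℒ.HasStandardConstructions)
    (hA : ∀ n, ℒ.Mem (A n)) (hM : ℒ.Models (ℒ.fullTheory (sumStr A : D → _)) M) : Ultrafilter D :=
  Ultrafilter.ofComplNotMemIff
    { sets := {S | subsetVal M S = 1}
      univ_sets := subsetVal_univ hℒ hcon hA hM
      sets_of_superset := subsetVal_mono hℒ hcon hA hM
      inter_sets := subsetVal_inter hℒ hcon hA hM }
    fun S => by
      change ¬ (subsetVal M Sᶜ = 1) ↔ subsetVal M S = 1
      rw [subsetVal_compl hℒ hcon hA hM, not_not]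

theorem isFibration_of_models_sumStr (hℒ : ℒ.IsLogicForMetricStructures)
    (hcon : ℒ.HasStandardConstructions) (hA : ∀ n, ℒ.Mem (A n))
    (hM : ℒ.Models (ℒ.fullTheory (sumStr A : D → _)) M) (f : D → ℕ) :
    (M.reduct (partHom L f)).IsFibration :=
  isFibration_of_models_fullTheory hℒ (mem_sumStr hℒ hcon hA) (partHom L f)
    (Sum.inr (.c (.inr f))) (fun γ => isFibration_sumStr A γ f)
    (fun γ b => (mem_fiber_sumStr (a := basePoint A γ f) (b := b)).2 rfl) hM

/-- The analogue of Łoś's theorem. In the sum for `γ` the `f`-part is a copy of `A (f γ)`, so "the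
proposition of `S` has value `0`, or `φ` holds in the `f`-part" is true in every sum and transfers.
-/
theorem val_part_eq_one (hℒ : ℒ.IsLogicForMetricStructures) (hreg : ℒ.IsRegular)
    (hcon : ℒ.HasStandardConstructions) (hA : ∀ n, ℒ.Mem (A n))
    (hM : ℒ.Models (ℒ.fullTheory (sumStr A : D → _)) M) {f : D → ℕ}
    (h : (M.reduct (partHom L f)).IsFibration) (b : M.carrier) {φ : ℒ.Sent L} {S : Set D}
    (hS : subsetVal M S = 1) (hφ : ∀ γ ∈ S, ℒ.val (A (f γ)) φ = 1) :
    ℒ.val (h.part b) φ = 1 := by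
  have key := ((expressible_subsetVal_eq_zero hℒ S _).or hℒ
    ((expressible_part hℒ hreg hcon φ).reduct (partHom L f)
      (partHom_injective L f))).transfer (mem_sumStr hℒ hcon hA)
    (fun γ => isFibration_sumStr A γ f) (fun γ => ?_) hM h
  · exact key.resolve_left (fun h0 => zero_ne_one (h0.symm.trans hS)) h b
  · by_cases hγ : γ ∈ S
    · refine Or.inr fun h b => ?_
      rw [← ℒ.iso_val φ (partIso A γ f h b) (hA _), hφ γ hγ]
    · exact Or.inl (subsetVal_sumStr_eq_zero hγ)

theorem models_part (hℒ : ℒ.IsLogicForMetricStructures) (hreg : ℒ.IsRegular)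
    (hcon : ℒ.HasStandardConstructions) {T : Set (ℒ.Sent L)} (hA : ∀ n, ℒ.Models T (A n))
    (hM : ℒ.Models (ℒ.fullTheory (sumStr A : D → _)) M) {f : D → ℕ}
    (h : (M.reduct (partHom L f)).IsFibration) (b : M.carrier) : ℒ.Models T (h.part b) :=
  ⟨mem_part hcon (ℒ.reduct_mem _ _ (partHom_injective L f) hM.1) h b, fun φ hφ =>
    val_part_eq_one hℒ hreg hcon (fun n => (hA n).1) hM h b
      (subsetVal_univ hℒ hcon (fun n => (hA n).1) hM) fun _ _ => (hA _).2 φ hφ⟩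

/-- If a family of sentences has no model together with `T`, but the first `n` of them hold in a
model `A n` of `T`, then every model of the theory of the sums gives rise to a countably complete
ultrafilter. -/
theorem countableInter_subsetUltrafilter (hℒ : ℒ.IsLogicForMetricStructures)
    (hreg : ℒ.IsRegular) (hcon : ℒ.HasStandardConstructions) {T : Set (ℒ.Sent L)}
    (hA : ∀ n, ℒ.Models T (A n)) {φ : ℕ → ℒ.Sent L} (hφ : ∀ i n, i ≤ n → ℒ.val (A n) (φ i) = 1)
    (hT : ∀ B, ℒ.Models T B → ∃ i, ℒ.val B (φ i) ≠ 1)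
    (hM : ℒ.Models (ℒ.fullTheory (sumStr A : D → _)) M) :
    CountableInterFilter (subsetUltrafilter hℒ hcon (fun n => (hA n).1) hM : Filter D) := by
  set U := subsetUltrafilter hℒ hcon (fun n => (hA n).1) hM
  -- Otherwise the `f`-part of `M` would be a model of `T` satisfying every `φ i`.
  have hbdd : ∀ f : D → ℕ, ∃ i, {γ | i ≤ f γ} ∉ U := by
    intro f
    have h := isFibration_of_models_sumStr hℒ hcon (fun n => (hA n).1) hM f
    obtain ⟨i, hi⟩ := hT _ (models_part hℒ hreg hcon hA hM h (Classical.arbitrary _))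
    exact ⟨i, fun hU => hi (val_part_eq_one hℒ hreg hcon (fun n => (hA n).1) hM h _ hU
      fun γ hγ => hφ i _ hγ)⟩
  have hseq : ∀ B : ℕ → Set D, (∀ n, B n ∈ U) → (⋂ n, B n) ∈ U := by
    classical
    intro B hB
    by_contra hn
    have hc : (⋂ n, B n)ᶜ ∈ U := Ultrafilter.compl_mem_iff_notMem.2 hn
    -- Outside the intersection, `f γ` is the index of a `B m` that omits `γ`. There `f γ ≥ i` as
    -- soon as `γ` lies in all `B j` with `j < i`, so `f` would be unbounded modulo `U`.
    have hf : ∀ γ, ∃ m, γ ∈ (⋂ n, B n)ᶜ → γ ∉ B m := by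
      intro γ
      by_cases hγ : γ ∈ ⋂ n, B n
      · exact ⟨0, fun h => absurd hγ h⟩
      · obtain ⟨m, hm⟩ := not_forall.1 fun h => hγ (Set.mem_iInter.2 h)
        exact ⟨m, fun _ => hm⟩
    choose f hf using hf
    obtain ⟨i, hi⟩ := hbdd f
    have hfin : (⋂ j ∈ {j | j < i}, B j) ∈ (U : Filter D) :=
      (Filter.biInter_mem (Set.finite_lt_nat i)).2 fun j _ => hB j
    refine hi (Filter.mem_of_superset (Filter.inter_mem hc hfin) ?_)
    rintro γ ⟨hγ, hγ'⟩
    by_contra hle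
    have hlt : f γ < i := lt_of_not_ge hle
    exact hf γ hγ (Set.mem_iInter₂.1 hγ' (f γ) hlt)
  refine ⟨fun S hS hSU => ?_⟩
  rcases S.eq_empty_or_nonempty with rfl | hne
  · simp
  · obtain ⟨B, rfl⟩ := hS.exists_eq_range hne
    rw [Set.sInter_range]
    exact hseq B fun n => hSU _ ⟨n, rfl⟩

/-- The proposition of `{γ}` is true only in the sum for `γ` itself, whose sequence is stationary
from `γ` on. -/
theorem dist_seqTerm_le_zero (hℒ : ℒ.IsLogicForMetricStructures)
    (hcon : ℒ.HasStandardConstructions) (hA : ∀ n, ℒ.Mem (A n))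
    (hM : ℒ.Models (ℒ.fullTheory (sumStr A : D → _)) M) {γ a b : D}
    (hγ : subsetVal M {γ} = 1) (ha : γ ≤ a) (hb : γ ≤ b) :
    dist (M.term (seqTerm L a)) (M.term (seqTerm L b)) ≤ 0 := by
  have key := ((expressible_subsetVal_eq_zero hℒ {γ} (fun _ => True)).or hℒ
    ((definable_dist hℒ (seqTerm L a) (seqTerm L b)).le hℒ
      (definable_const hℒ le_rfl zero_le_one) _)).transfer (mem_sumStr hℒ hcon hA)
    (fun _ => trivial) (fun γ' => ?_) hM trivial
  · simpa [hγ] using key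
  · by_cases h : γ' = γ
    · subst h
      right
      rw [term_seqTerm, term_seqTerm, min_eq_right ha, min_eq_right hb, dist_self, Rat.cast_zero]
    · exact Or.inl (subsetVal_sumStr_eq_zero h)

end Model

/-- A sampling by `i` and some `s i > i` is defeated only by stationarity at `i`, and this can be
postponed past any finite set of candidates. -/
theorem not_uniformlyMetastableModulo_seqTerm [NoMaxOrder D]
    (hℒ : ℒ.IsLogicForMetricStructures) (hcon : ℒ.HasStandardConstructions)
    {A : ℕ → MetricStr L} (hA : ∀ n, ℒ.Mem (A n)) :
    ¬ ℒ.UniformlyMetastableModulo (ℒ.fullTheory (sumStr A : D → _)) (seqTerm L) := by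
  rintro ⟨E, hne, hE⟩
  choose s hs using fun a : D => exists_gt a
  let η : Sampling D := ⟨fun i => {i, s i}, fun i => ⟨i, by simp⟩, fun i l hl => by
    rcases Finset.mem_insert.1 hl with rfl | hl
    · exact le_rfl
    · rw [Finset.mem_singleton.1 hl]
      exact (hs i).le⟩
  have hpos : (0 : ℝ) < 1 / 2 := by norm_num
  -- In the sum for this `γ`, the terms at `i` and `s i` lie in different summands for every `i` in
  -- the finite set.
  obtain ⟨γ, hγ⟩ : ∃ γ, ∀ a ∈ E (1 / 2) η, s a ≤ γ :=
    ⟨((E (1 / 2) η).image s).max' ((hne _ hpos η).image s),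
      fun a ha => Finset.le_max' _ _ (Finset.mem_image_of_mem s ha)⟩
  obtain ⟨i, hi, h⟩ := hE _ (models_fullTheory (mem_sumStr hℒ hcon hA) γ) _ hpos η
  have h1 := h i (by simp [η]) (s i) (by simp [η])
  rw [term_seqTerm, term_seqTerm, min_eq_left ((hs i).le.trans (hγ i hi)), min_eq_left (hγ i hi),
    dist_of_summand_ne] at h1
  · norm_num at h1
  · exact fun h => (hs i).ne (pointIndicator_injective h)

end MetricValuedLogic

end

/-! ### From `κ`-sequences to `ω`-sequences. -/

theorem theorem4p9 (ℒ : MetricValuedLogic.{u, v}) (hℒ : ℒ.IsLogicForMetricStructures)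
    (hreg : ℒ.IsRegular) (hcon : ℒ.HasStandardConstructions)
    (κ : Cardinal.{u}) (hκ : Cardinal.aleph0 ≤ κ)
    (hmeas : ∀ μ : Cardinal.{u}, IsMeasurableCardinal μ → κ < μ)
    (hUMP : ℒ.UMP κ.ord.ToType) :
    ℒ.UMP ℕ := by
  intro L T t hT
  refine ⟨fun hC => ?_, fun h => h.cauchyModulo⟩
  by_contra hn
  obtain ⟨ε, hε, η, h⟩ :=
    MetricValuedLogic.exists_models_of_not_uniformlyMetastableModulo hn
  -- Oscillation `> ε` is weakened to `≥ r`, a closed condition with a rational bound, so that it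
  -- becomes expressible.
  obtain ⟨r, hr0, hr1, hr⟩ := exists_rat_pos_le_one_lt hε
  choose A hA hAη using fun n => h (Finset.range (n + 1)) ⟨0, by simp⟩
  have hexp : ∀ i, ℒ.Expressible (fun _ => True) fun M => ∃ j ∈ η.set i, ∃ k ∈ η.set i,
      (r : ℝ) ≤ dist (M.term (t j)) (M.term (t k)) := fun i =>
    .exists_mem hℒ (fun j => .exists_mem hℒ (fun k =>
      (MetricValuedLogic.definable_const hℒ hr0.le hr1).le hℒ
        (MetricValuedLogic.definable_dist hℒ (t j) (t k)) _) _) _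
  choose φ hφ using hexp
  have hφA : ∀ i n, i ≤ n → ℒ.val (A n) (φ i) = 1 := by
    intro i n hin
    obtain ⟨j, hj, k, hk, hjk⟩ := hAη n i (Finset.mem_range_succ_iff.2 hin)
    exact (hφ i _ (hA n).1 trivial).2 ⟨j, hj, k, hk, (hr.trans hjk).le⟩
  have hφT : ∀ B, ℒ.Models T B → ∃ i, ℒ.val B (φ i) ≠ 1 := by
    intro B hB
    have hr0' : (0 : ℝ) < r := by exact_mod_cast hr0
    -- Since `η.set i` lies beyond `i`, its oscillation is at most `r / 2 < r`, so `φ i` fails.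
    obtain ⟨i, hi⟩ := hC B hB (r / 2) (by linarith)
    refine ⟨i, fun h1 => ?_⟩
    obtain ⟨j, hj, k, hk, hjk⟩ := (hφ i B hB.1 trivial).1 h1
    linarith [hi j k (η.le_of_mem i j hj) (η.le_of_mem i k hk)]
  have : NoMaxOrder κ.ord.ToType := Cardinal.noMaxOrder hκ
  -- By the principle for `κ`, it remains to see that the sequence of constants is Cauchy modulo the
  -- common theory.
  refine MetricValuedLogic.not_uniformlyMetastableModulo_seqTerm (D := κ.ord.ToType) hℒ hcon
    (fun n => (hA n).1) ((hUMP _ _ (uniform_sumStr hℒ hcon hT hA)).1 fun M hM δ hδ => ?_)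
  have := MetricValuedLogic.countableInter_subsetUltrafilter hℒ hreg hcon hA hφA hφT hM
  obtain ⟨γ, hγ⟩ := Ultrafilter.exists_singleton_mem_of_no_measurable
    (MetricValuedLogic.subsetUltrafilter hℒ hcon (fun n => (hA n).1) hM)
    (by rwa [Cardinal.mk_ord_toType])
  exact ⟨γ, fun a b ha hb => (MetricValuedLogic.dist_seqTerm_le_zero hℒ hcon (fun n => (hA n).1)
    hM hγ ha hb).trans hδ.le⟩
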